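/- Let $\Gamma,\Sigma$ be finite alphabets and let $\mathbf R=(R,\Gamma,c,\Sigma)$ be a representation system: $R\subseteq\Gamma^*$, and $c$ maps each $r\in R$ to a language $c(r)\subseteq\Sigma^*$; assume that $r\in R$ and "$r \in R$ and $x\in c(r)$" are decidable. Write $R^{\le s}$ for the set of $r \in R$ of length at most $s$, and $\Sigma^{\le n}$ for the set of strings over $\Sigma$ of length at most $n$. Numerical parameters handed to algorithms are positive rationals. Let $L$ be a deterministic pac-algorithm for $\mathbf R$: for all $s,n\ge1$, $\epsilon,\delta>0$, every target $r\in R^{\le s}$ and every probability distribution $D$ on $\Sigma^{\le n}$, on input $s,n,\epsilon,\delta$ and with access to independent examples drawn from $D$ and labelled according to $c(r)$, $L$ outputs with probability at least $1-\delta$ an $r'\in R$ with $D(c(r')\Delta c(r))\le\epsilon$. Let $m(n,s,\epsilon,\delta)$ be a (real-valued) bound on its sample size, nonincreasing in $\epsilon$ and in $\delta$: on every sequence of labelled examples from $\Sigma^{\le n}$ of a target in $R^{\le s}$, $L$ halts after reading at most $m(n,s,\epsilon,\delta)$ examples. Let $E$ be an exception handler for $\mathbf R$: an algorithm that, given $r\in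 R$ and $x\in\Sigma^*$, outputs an $r'\in R$ with $c(r')=c(r)\Delta\{x\}$, of length at most $e(|r|,|x|)$ for some function $e$. Let $K(\cdot\mid\cdot)$ be conditional prefix Kolmogorov complexity with respect to an optimal prefix machine, and let $\ell=\max(1,\log_2|\Sigma|)$ (so $\ell=1$ for a binary alphabet). (a) Let $m,n,s\ge1$ and $\gamma>0$ satisfy $m\ge 2n\,m(n,s,\frac1{2n},\gamma)$, and suppose that $\epsilon\mapsto m(n,s,\epsilon,\gamma)$ is continuous on $(0,\infty)$ and not everywhere $\le 0$. Then there is exactly one $\epsilon>0$ with $m(n,s,\epsilon,\gamma)=\epsilon m$. (b) Let $\epsilon=\epsilon(m,n,s,\gamma)$ be any real-valued function, and call $(m,n,s,\gamma)$, with $m,n,s\ge1$ and $\gamma>0$, admissible if $m\ge 2n\,m(n,s,\frac1{2n},\gamma)$, $\epsilon(m,n,s,\gamma)>0$ and $m(n,s,\epsilon,\gamma)=\epsilon m$ for $\epsilon=\epsilon(m,n,s,\gamma)$. For admissible arguments $\epsilon\le\frac1{2n}$, and there is an Occam-algorithm for $\mathbf R$ with compression $$f(m,n,s,\gamma)=\frac{1}{2\epsilon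 n\ell}$$ (that is, $\frac1{2\epsilon n}$ for a binary example alphabet) on the admissible arguments. This means: $f$ is strictly increasing in $m$; and there is a randomized algorithm such that for every $\gamma_0<1$ there is a constant $C$ such that for all $s,n\ge1$, all rational $\gamma\in(0,\gamma_0]$, every target $r\in R^{\le s}$ and every sample of $m$ labelled examples of $r$ from $\Sigma^{\le n}$ with $(m,n,s,\gamma)$ admissible, on input $n,s,\gamma$ and the sample the algorithm outputs, with probability at least $1-\gamma$, an $r'\in R$ that is consistent with the sample and satisfies $$K(r'\mid r,n,s)<\frac{m}{f(m,n,s,\gamma)}+C .$$ -/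

import Mathlib

open MeasureTheory Set
open scoped ENNReal

noncomputable section

/-- Finite strings carry the discrete sigma-algebra. -/
instance stringMeasurableSpace {α : Type*} : MeasurableSpace (List α) := ⊤

/-- A representation system over the alphabet `G` of representations and the alphabet `A` of
examples: a set of representations and, for each of them, a language over `A`. -/
structure RepSystem (G A : Type*) where
  reps : Set (List G)
  concept : reps → Set (List A)

/-- A positive rational parameter is handed to an algorithm as a pair numerator, denominator. -/
def fracVal (q : ℕ × ℕ) : ℝ := (q.1 : ℝ) / (q.2 : ℝ)

/-! ### Algorithms that read a source of tokens -/

/-- An algorithm with input of type `ι` that may request tokens of type `τ` one at a time (labelled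
examples from an oracle, or coin flips). Given the input and the list of tokens received so far, it
runs and then either requests one more token (value `none`) or stops with an output `y`
(value `some y`); it may also diverge. It is an algorithm in the proper sense if it is `Partrec`. -/
abbrev TokenAlgorithm (ι τ o : Type*) := ι × List τ →. Option o

/-- On input `i` and with the token stream `w`, the algorithm stops with output `y` after having
read exactly `t` tokens. -/
def TokenAlgorithm.Outputs {ι τ o : Type*} (P : TokenAlgorithm ι τ o) (i : ι) (w : ℕ → τ)
    (t : ℕ) (y : o) : Prop :=
  (∀ u < t, none ∈ P (i, (List.range u).map w)) ∧ some y ∈ P (i, (List.range t).map w)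

/-- The law of an infinite sequence of independent fair coin flips. -/
def coinMeasure : Measure (ℕ → Bool) :=
  Measure.infinitePi fun _ : ℕ => (PMF.uniformOfFintype Bool).toMeasure

/-- The law of an infinite sequence of independent examples drawn according to `D`. -/
def exampleMeasure {A : Type*} (D : PMF (List A)) : Measure (ℕ → List A) :=
  Measure.infinitePi fun _ : ℕ => D.toMeasure

namespace RepSystem

variable {G A : Type*}

open Classical in
/-- The example `x` labelled according to the target `r`. -/
def label (R : RepSystem G A) (r : R.reps) (x : List A) : List A × Bool :=
  (x, decide (x ∈ R.concept r))

/-- Both the property of being a representation and the membership of a string in the concept of a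
representation are decidable by algorithms. -/
def IsDecidable [Primcodable G] [Primcodable A] (R : RepSystem G A) : Prop :=
  ComputablePred (fun r : List G => r ∈ R.reps) ∧
  ComputablePred (fun p : List G × List A => ∃ h : p.1 ∈ R.reps, p.2 ∈ R.concept ⟨p.1, h⟩)

end RepSystem

/-! ### Pac-algorithms -/

/-- A deterministic pac-algorithm. The input is `(s, n, ε, δ)`, the tokens are labelled examples. -/
def IsDeterministicPac {G A : Type*} [Primcodable G] [Primcodable A] (R : RepSystem G A)
    (L : TokenAlgorithm (ℕ × ℕ × (ℕ × ℕ) × (ℕ × ℕ)) (List A × Bool) (List G)) : Prop :=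
  Partrec L ∧
  ∀ s n : ℕ, 1 ≤ s → 1 ≤ n → ∀ ε δ : ℕ × ℕ, 0 < fracVal ε → 0 < fracVal δ →
    ∀ r : R.reps, (r : List G).length ≤ s →
    ∀ D : PMF (List A), (∀ x ∈ D.support, x.length ≤ n) →
      ENNReal.ofReal (1 - fracVal δ) ≤
        exampleMeasure D {w | ∃ (t : ℕ) (r' : R.reps),
          L.Outputs (s, n, ε, δ) (fun i => R.label r (w i)) t (r' : List G) ∧
          D.toMeasure (symmDiff (R.concept r') (R.concept r)) ≤ ENNReal.ofReal (fracVal ε)}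

/-- `L` has sample size `m(n, s, ε, δ)`: on every sequence of examples of length at most `n` of a
target of length at most `s` it stops after at most `m(n, s, ε, δ)` examples. -/
def HasSampleSize {G A : Type*} (R : RepSystem G A)
    (L : TokenAlgorithm (ℕ × ℕ × (ℕ × ℕ) × (ℕ × ℕ)) (List A × Bool) (List G))
    (mL : ℕ → ℕ → ℝ → ℝ → ℝ) : Prop :=
  ∀ s n : ℕ, 1 ≤ s → 1 ≤ n → ∀ ε δ : ℕ × ℕ, 0 < fracVal ε → 0 < fracVal δ →
    ∀ r : R.reps, (r : List G).length ≤ s →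
    ∀ w : ℕ → List A, (∀ i, (w i).length ≤ n) →
      ∃ (t : ℕ) (y : List G), L.Outputs (s, n, ε, δ) (fun i => R.label r (w i)) t y ∧
        (t : ℝ) ≤ mL n s (fracVal ε) (fracVal δ)

/-- A sample size does not increase when accuracy or confidence are relaxed. -/
def IsDecreasingSampleSize (mL : ℕ → ℕ → ℝ → ℝ → ℝ) : Prop :=
  ∀ n s : ℕ, 1 ≤ n → 1 ≤ s → ∀ ε ε' δ δ' : ℝ, 0 < ε → ε ≤ ε' → 0 < δ → δ ≤ δ' →
    mL n s ε' δ' ≤ mL n s ε δ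

/-! ### Exception handlers -/

/-- An exception handler with exception expansion function `e`. -/
def IsExceptionHandler {G A : Type*} [Primcodable G] [Primcodable A] (R : RepSystem G A)
    (E : List G × List A →. List G) (e : ℕ → ℕ → ℕ) : Prop :=
  Partrec E ∧
  ∀ (r : R.reps) (x : List A), ∃ r' : R.reps, (r' : List G) ∈ E ((r : List G), x) ∧
    R.concept r' = symmDiff (R.concept r) {x} ∧
    (r' : List G).length ≤ e (r : List G).length x.length

/-! ### Conditional prefix Kolmogorov complexity -/

/-- A (conditional) prefix machine: input is a binary program and a condition, and for each
condition the set of halting programs is prefix-free. -/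
def IsPrefixMachine (M : List Bool × ℕ →. ℕ) : Prop :=
  Partrec M ∧
  ∀ (y : ℕ) (p q : List Bool), p <+: q → (M (p, y)).Dom → (M (q, y)).Dom → p = q

/-- A reference (additively optimal) prefix machine. -/
def IsOptimalPrefixMachine (U : List Bool × ℕ →. ℕ) : Prop :=
  IsPrefixMachine U ∧
  ∀ M : List Bool × ℕ →. ℕ, IsPrefixMachine M →
    ∃ C : ℕ, ∀ (p : List Bool) (y x : ℕ), x ∈ M (p, y) →
      ∃ p' : List Bool, x ∈ U (p', y) ∧ p'.length ≤ p.length + C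

/-- The conditional Kolmogorov complexity `K(x | y)` with respect to the machine `U`. -/
def condK {X Y : Type*} [Encodable X] [Encodable Y] (U : List Bool × ℕ →. ℕ) (x : X) (y : Y) : ℕ∞ :=
  ⨅ (p : List Bool) (_ : Encodable.encode x ∈ U (p, Encodable.encode y)), (p.length : ℕ∞)

/-! ### Occam-algorithms -/

/-- A randomized Occam-algorithm `O` with compression `f(m, n, s, γ)`, the latter being defined for
the arguments in `dom`. The input is `(n, s, γ, sample)`, the tokens are coin flips.
As always for Kolmogorov complexity, the bound on `K(r' | r, n, s)` is up to an additive constant,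
which is uniform as long as `γ` stays away from `1`; for `1 ≤ γ` nothing is required of `O`. -/
def IsOccamAlgorithm {G A : Type*} [Primcodable G] [Primcodable A] (R : RepSystem G A)
    (U : List Bool × ℕ →. ℕ)
    (O : TokenAlgorithm (ℕ × ℕ × (ℕ × ℕ) × List (List A × Bool)) Bool (List G))
    (dom : ℕ → ℕ → ℕ → ℝ → Prop) (f : ℕ → ℕ → ℕ → ℝ → ℝ) : Prop :=
  Partrec O ∧
  (∀ n s : ℕ, 1 ≤ n → 1 ≤ s → ∀ γ : ℝ, 0 < γ → ∀ m m' : ℕ, m < m' →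
    dom m n s γ → dom m' n s γ → f m n s γ < f m' n s γ) ∧
  ∀ γ₀ : ℝ, γ₀ < 1 → ∃ C : ℕ,
    ∀ s n : ℕ, 1 ≤ s → 1 ≤ n → ∀ γ : ℕ × ℕ, 0 < fracVal γ → fracVal γ ≤ γ₀ →
    ∀ r : R.reps, (r : List G).length ≤ s →
    ∀ xs : List (List A), (∀ x ∈ xs, x.length ≤ n) → dom xs.length n s (fracVal γ) →
      ENNReal.ofReal (1 - fracVal γ) ≤
        coinMeasure {w | ∃ (t : ℕ) (r' : R.reps),
          O.Outputs (n, s, γ, xs.map (R.label r)) w t (r' : List G) ∧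
          (∀ x ∈ xs, x ∈ R.concept r' ↔ x ∈ R.concept r) ∧
          ((condK U (r' : List G) ((r : List G), n, s) : ℕ∞) : ℝ≥0∞) <
            ENNReal.ofReal ((xs.length : ℝ) / f xs.length n s (fracVal γ)) + (C : ℝ≥0∞)}

/-- The number of bits per symbol of the alphabet `A` (equal to `1` for a binary alphabet). -/
def bitsPerSymbol (A : Type*) : ℝ := max 1 (Real.logb 2 (Nat.card A))

/-- The arguments `(m, n, s, γ)` for which the compression is claimed: the sample size `m` is at
least `2 n m(n, s, 1/(2n), γ)` and `ε(m, n, s, γ) > 0` solves `m(n, s, ε, γ) = ε m`. -/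
def OccamDomain (mL : ℕ → ℕ → ℝ → ℝ → ℝ) (eps : ℕ → ℕ → ℕ → ℝ → ℝ) (m n s : ℕ) (γ : ℝ) : Prop :=
  1 ≤ m ∧ 2 * (n : ℝ) * mL n s (1 / (2 * (n : ℝ))) γ ≤ (m : ℝ) ∧
  0 < eps m n s γ ∧ mL n s (eps m n s γ) γ = eps m n s γ * (m : ℝ)

end

/-! ### Computable operations on lists -/

section ComputableLists

variable {α β σ : Type*} [Primcodable α] [Primcodable β] [Primcodable σ]

/-! The Occam-algorithm is plain search: it returns the first representation of length at most `s`,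
in a fixed enumeration, that agrees with the sample. The learner is never run; learnability serves
only to limit how many different outputs there can be. The output is recovered from its own
labelling of the words of length at most `n` (`firstConsistent_fullSample`), so given `n` and `s` it
is named by an index into the list of such labellings. By `exists_condK_le_of_mem_list` this index
needs no extra delimiting bits, because its length is computable from the condition.

Let Q = m(n, s, 1/(2n), γ). As ε ≤ 1/(2n), monotonicity gives Q ≤ m(n, s, ε, γ) = εm, so it suffices
to number the labellings with 2Qnℓ + O(1) bits (`exists_clog_card_traces_le`). Sauer-Shelah bounds
the required number of bits by d(nℓ + 1), where d bounds the sizes of shattered sets.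

To bound d, draw examples uniformly from a shattered set X. On a fixed stream, a target learned
successfully is determined on X by at most Q labels and by the small set where the output errs.
Counting gives (1 - γ) 2^|X| ≤ 2^Q · 2^(|X|/4), hence |X| ≤ 4/3 (Q + c₀) with c₀ depending only on
γ₀. To absorb c₀, Q must grow with `n`: among three traces, two agree on one word and differ on
another, which forces Q ≥ n(1 - γ). At most two traces, or bounded `n`, cost only a constant. -/

theorem Computable.list_foldl {f : α → List β} {g : α → σ} {h : α → σ × β → σ}
    (hf : Computable f) (hg : Computable g) (hh : Computable₂ h) :
    Computable fun a => (f a).foldl (fun s b => h a (s, b)) (g a) := by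
  -- The fold becomes a recursion on an index. Below the length the lookup succeeds, so the fallback
  -- `s` only makes the step total.
  have key : Computable fun a => Nat.rec (motive := fun _ => σ) (g a)
      (fun k s => ((f a)[k]?).elim s fun b => h a (s, b)) (f a).length := by
    refine Computable.nat_rec (h := fun a (p : ℕ × σ) =>
      ((f a)[p.1]?).elim p.2 fun b => h a (p.2, b)) (Computable.list_length.comp hf) hg ?_
    have h1 : Computable fun q : α × ℕ × σ => (f q.1)[q.2.1]? :=
      Computable.list_getElem?.comp (hf.comp .fst) (Computable.fst.comp .snd)
    have h2 : Computable₂ fun (q : α × ℕ × σ) (b : β) => h q.1 (q.2.2, b) :=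
      Computable₂.comp hh (Computable.fst.comp .fst)
        (((Computable.snd.comp .snd).comp .fst).pair .snd)
    refine Computable₂.mk ((Computable.option_casesOn h1 (Computable.snd.comp .snd) h2).of_eq ?_)
    rintro ⟨a, k, s⟩
    cases (f a)[k]? <;> simp
  refine key.of_eq fun a => ?_
  have aux : ∀ k ≤ (f a).length, Nat.rec (motive := fun _ => σ) (g a)
      (fun k s => ((f a)[k]?).elim s fun b => h a (s, b)) k =
      ((f a).take k).foldl (fun s b => h a (s, b)) (g a) := by
    intro k hk
    induction k with
    | zero => simp
    | succ k ih =>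
      have hlt : k < (f a).length := hk
      rw [List.take_add_one, List.foldl_append, ← ih hlt.le]
      simp [hlt]
  simpa using aux _ le_rfl

theorem Computable.list_map {f : α → List β} {g : α → β → σ}
    (hf : Computable f) (hg : Computable₂ g) : Computable fun a => (f a).map (g a) := by
  refine (Computable.list_foldl (g := fun _ => ([] : List σ))
    (h := fun a (p : List σ × β) => p.1 ++ [g a p.2]) hf (Computable.const []) ?_).of_eq fun a => ?_
  · exact (Computable.list_concat.comp (Computable.fst.comp .snd)
      (Computable₂.comp hg .fst (Computable.snd.comp .snd))).to₂
  · have : ∀ (l : List β) (acc : List σ),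
        l.foldl (fun s b => s ++ [g a b]) acc = acc ++ l.map (g a) := by
      intro l
      induction l with
      | nil => simp
      | cons b l ih => intro acc; simp [ih]
    simpa using this (f a) []

theorem Computable.list_all {f : α → List β} {p : α → β → Bool}
    (hf : Computable f) (hp : Computable₂ p) : Computable fun a => (f a).all (p a) := by
  refine (Computable.list_foldl (g := fun _ => true)
    (h := fun a (q : Bool × β) => q.1 && p a q.2) hf (Computable.const true) ?_).of_eq fun a => ?_
  · exact (Primrec.and.to_comp.comp (Computable.fst.comp .snd)
      (Computable₂.comp hp .fst (Computable.snd.comp .snd))).to₂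
  · have : ∀ (l : List β) (acc : Bool),
        l.foldl (fun s b => s && p a b) acc = (acc && l.all (p a)) := by
      intro l
      induction l with
      | nil => simp
      | cons b l ih => intro acc; simp [ih, Bool.and_assoc]
    simpa using this (f a) true

theorem Computable.list_find? {f : α → List β} {p : α → β → Bool}
    (hf : Computable f) (hp : Computable₂ p) : Computable fun a => (f a).find? (p a) := by
  refine (Computable.list_foldl (g := fun _ => (none : Option β))
    (h := fun a (q : Option β × β) => q.1.elim (bif p a q.2 then some q.2 else none) some)
    hf (Computable.const none) ?_).of_eq fun a => ?_
  · have h1 : Computable fun q : α × Option β × β => bif p q.1 q.2.2 then some q.2.2 else none :=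
      Computable.cond (Computable₂.comp hp .fst (Computable.snd.comp .snd))
        (Computable.option_some.comp (Computable.snd.comp .snd)) (Computable.const none)
    have h2 : Computable₂ fun (_ : α × Option β × β) (b : β) => some b :=
      (Computable.option_some.comp .snd).to₂
    refine Computable₂.mk
      ((Computable.option_casesOn (Computable.fst.comp .snd) h1 h2).of_eq ?_)
    rintro ⟨a, o, b⟩
    cases o <;> simp
  · have h1 : ∀ (l : List β) (b : β), l.foldl (fun (o : Option β) b =>
        o.elim (bif p a b then some b else none) some) (some b) = some b := by
      intro l b
      induction l with
      | nil => rfl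
      | cons c l ih => simpa using ih
    have h2 : ∀ l : List β, l.foldl (fun (o : Option β) b =>
        o.elim (bif p a b then some b else none) some) none = l.find? (p a) := by
      intro l
      induction l with
      | nil => rfl
      | cons c l ih =>
        cases hc : p a c
        · simpa [hc] using ih
        · simpa [hc] using h1 l c
    exact h2 (f a)

open Classical in
theorem Computable.list_insert_last :
    Computable₂ fun (l : List β) (b : β) => if b ∈ l then l else l ++ [b] := by
  have h1 : Primrec fun q : List β × β => decide (q.1.idxOf q.2 < q.1.length) :=
    (PrimrecPred.decide (PrimrecRel.comp Primrec.nat_lt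
      (Primrec.list_idxOf.comp .snd .fst) (Primrec.list_length.comp .fst)))
  refine Computable₂.mk
    ((Computable.cond h1.to_comp .fst (Computable.list_concat.comp .fst .snd)).of_eq ?_)
  rintro ⟨l, b⟩
  by_cases hb : b ∈ l
  · simp [hb, List.idxOf_lt_length_iff]
  · simp [hb]

end ComputableLists

/-! ### Words of bounded length -/

/-- A list of the words of length at most `n` over a finite alphabet. -/
noncomputable def wordsUpTo (G : Type*) [Finite G] : ℕ → List (List G)
  | 0 => [[]]
  | n + 1 => [] :: (wordsUpTo G n).flatMap fun w =>
      (Fintype.ofFinite G).elems.toList.map fun g => g :: w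

section Words

variable {G : Type*} [Finite G]

theorem mem_wordsUpTo {n : ℕ} {w : List G} : w ∈ wordsUpTo G n ↔ w.length ≤ n := by
  induction n generalizing w with
  | zero => simp [wordsUpTo]
  | succ n ih =>
    cases w with
    | nil => simp [wordsUpTo]
    | cons g w =>
      have : g ∈ (Fintype.ofFinite G).elems := (Fintype.ofFinite G).complete g
      simp [wordsUpTo, ih, this]

theorem primrec_wordsUpTo [Primcodable G] : Primrec (wordsUpTo G) := by
  have step : Primrec₂ fun (_ : ℕ) (p : ℕ × List (List G)) =>
      [] :: p.2.flatMap fun w => (Fintype.ofFinite G).elems.toList.map fun g => g :: w := by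
    have h1 : Primrec fun q : ℕ × ℕ × List (List G) => q.2.2.flatMap fun w =>
        (Fintype.ofFinite G).elems.toList.map fun g => g :: w := by
      refine Primrec.list_flatMap (Primrec.snd.comp .snd) ?_
      have h2 : Primrec₂ fun (p : (ℕ × ℕ × List (List G)) × List G) (g : G) => g :: p.2 :=
        (Primrec.list_cons.comp .snd (Primrec.snd.comp .fst)).to₂
      exact (Primrec.list_map (Primrec.const (Fintype.ofFinite G).elems.toList) h2).to₂
    exact (Primrec.list_cons.comp (Primrec.const ([] : List G)) h1).to₂
  refine (Primrec.nat_rec' (f := id) (g := fun _ => ([[]] : List (List G))) .id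
    (Primrec.const ([[]] : List (List G))) step).of_eq ?_
  intro n
  induction n with
  | zero => rfl
  | succ n ih =>
    simp only [id] at ih ⊢
    rw [wordsUpTo, ← ih]

/-- The extra 1 closes the induction and is the 1 of the Sauer-Shelah bound `(W.card + 1) ^ d`; the
`max 2` covers alphabets with fewer than two letters. -/
theorem length_wordsUpTo_lt (n : ℕ) :
    (wordsUpTo G n).length + 1 ≤ 2 * max 2 (Nat.card G) ^ n := by
  induction n with
  | zero => simp [wordsUpTo]
  | succ n ih =>
    have hc : (Fintype.ofFinite G).elems.toList.length = Nat.card G := by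
      let _ := Fintype.ofFinite G
      simp only [Finset.length_toList, Nat.card_eq_fintype_card]
      rfl
    have hl : (wordsUpTo G (n + 1)).length = (wordsUpTo G n).length * Nat.card G + 1 := by
      simp only [wordsUpTo, List.length_cons, List.length_flatMap, List.length_map, hc]
      simp
    rw [hl, pow_succ]
    set a := max 2 (Nat.card G)
    have ha : Nat.card G ≤ a := le_max_right _ _
    have ha2 : 2 ≤ a := le_max_left _ _
    calc (wordsUpTo G n).length * Nat.card G + 1 + 1
        ≤ (wordsUpTo G n).length * a + a := by
          have := Nat.mul_le_mul_left (wordsUpTo G n).length ha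
          omega
      _ = ((wordsUpTo G n).length + 1) * a := by ring
      _ ≤ 2 * a ^ n * a := Nat.mul_le_mul_right _ ih
      _ = 2 * (a ^ n * a) := by ring

end Words

/-! ### Binary indices -/

/-- The number written in binary by a list of digits, least significant digit first. -/
def bitsVal (p : List Bool) : ℕ := p.foldr (fun b v => b.toNat + 2 * v) 0

theorem primrec_bitsVal : Primrec bitsVal := by
  refine Primrec.list_foldr (f := fun p : List Bool => p) (g := fun _ => 0)
    (h := fun _ (q : Bool × ℕ) => q.1.toNat + 2 * q.2) .id (Primrec.const 0) ?_
  refine (Primrec.nat_add.comp ((Primrec.dom_finite Bool.toNat).comp (Primrec.fst.comp .snd))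
    (Primrec.nat_mul.comp (Primrec.const 2) (Primrec.snd.comp .snd))).to₂

theorem exists_bitsVal_eq (k j : ℕ) (hj : j < 2 ^ k) : ∃ p : List Bool, p.length = k ∧
    bitsVal p = j := by
  induction k generalizing j with
  | zero => exact ⟨[], rfl, by simp [bitsVal]; omega⟩
  | succ k ih =>
    obtain ⟨p, hp, hv⟩ := ih (j / 2) (by rw [pow_succ] at hj; omega)
    refine ⟨decide (j % 2 = 1) :: p, by simp [hp], ?_⟩
    change (decide (j % 2 = 1)).toNat + 2 * bitsVal p = j
    rw [hv]
    rcases Nat.mod_two_eq_zero_or_one j with h | h <;> simp [h] <;> omega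

/-! ### The first consistent representation -/

namespace RepSystem

variable {G A : Type*}

open Classical in
/-- Membership of a string in the set of representations, as a Boolean. -/
noncomputable def isRep (R : RepSystem G A) (r : List G) : Bool := decide (r ∈ R.reps)

open Classical in
/-- Membership of a string in the concept of a representation, as a Boolean. -/
noncomputable def classify (R : RepSystem G A) (r : List G) (x : List A) : Bool :=
  decide (∃ h : r ∈ R.reps, x ∈ R.concept ⟨r, h⟩)

theorem isRep_iff {R : RepSystem G A} {r : List G} : R.isRep r = true ↔ r ∈ R.reps := by
  simp [isRep]

theorem classify_coe {R : RepSystem G A} {r : R.reps} {x : List A} :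
    R.classify r x = true ↔ x ∈ R.concept r := by
  simp [classify]

theorem label_eq (R : RepSystem G A) (r : R.reps) (x : List A) :
    R.label r x = (x, R.classify r x) := by
  by_cases h : x ∈ R.concept r <;> simp [label, classify, h]

theorem IsDecidable.computable_isRep [Primcodable G] [Primcodable A]
    {R : RepSystem G A} (hR : R.IsDecidable) :
    Computable R.isRep := by
  obtain ⟨_, h⟩ := hR.1
  exact h.of_eq fun r => by simp [isRep]

theorem IsDecidable.computable_classify [Primcodable G] [Primcodable A]
    {R : RepSystem G A} (hR : R.IsDecidable) :
    Computable₂ R.classify := by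
  obtain ⟨_, h⟩ := hR.2
  exact Computable₂.mk (h.of_eq fun p => by simp [classify])

/-- `r` is a representation that labels all the examples of a sample as the sample does. -/
noncomputable def consistent (R : RepSystem G A) (sample : List (List A × Bool)) (r : List G) : Bool :=
  R.isRep r && sample.all fun p => R.classify r p.1 == p.2

theorem consistent_iff {R : RepSystem G A} {sample : List (List A × Bool)} {r : List G} :
    R.consistent sample r = true ↔ r ∈ R.reps ∧ ∀ p ∈ sample, R.classify r p.1 = p.2 := by
  simp [consistent, isRep_iff]

theorem consistent_map_label {R : RepSystem G A} {xs : List (List A)} {r : R.reps} {r' : List G} :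
    R.consistent (xs.map (R.label r)) r' = true ↔
      r' ∈ R.reps ∧ ∀ x ∈ xs, R.classify r' x = R.classify r x := by
  simp [consistent_iff, label_eq]

theorem IsDecidable.computable_consistent [Primcodable G] [Primcodable A]
    {R : RepSystem G A} (hR : R.IsDecidable) :
    Computable₂ R.consistent := by
  refine Primrec.and.to_comp.comp (hR.computable_isRep.comp .snd)
    (Computable.list_all (f := fun q : List (List A × Bool) × List G => q.1)
      (p := fun q p => R.classify q.2 p.1 == p.2) .fst ?_)
  have h1 : Computable fun q : (List (List A × Bool) × List G) × (List A × Bool) =>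
      R.classify q.1.2 q.2.1 :=
    hR.computable_classify.comp (Computable.snd.comp .fst) (Computable.fst.comp .snd)
  exact (Primrec.beq.to_comp.comp h1 (Computable.snd.comp .snd)).to₂

/-- All examples of length at most `n`, labelled by `r`. -/
noncomputable def fullSample [Finite A] (R : RepSystem G A) (n : ℕ) (r : List G) : List (List A × Bool) :=
  (wordsUpTo A n).map fun x => (x, R.classify r x)

theorem IsDecidable.computable_fullSample [Finite A] [Primcodable G] [Primcodable A]
    {R : RepSystem G A} (hR : R.IsDecidable) :
    Computable₂ R.fullSample :=
  Computable.list_map (f := fun q : ℕ × List G => wordsUpTo A q.1)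
    (g := fun q x => (x, R.classify q.2 x)) (primrec_wordsUpTo.to_comp.comp .fst)
    (Computable.pair .snd (hR.computable_classify.comp (Computable.snd.comp .fst) .snd))

variable [Finite G]

/-- The first representation of length at most `s` that is consistent with a sample. -/
noncomputable def firstConsistent (R : RepSystem G A) (s : ℕ) (sample : List (List A × Bool)) :
    Option (List G) :=
  (wordsUpTo G s).find? (R.consistent sample)

theorem IsDecidable.computable_firstConsistent [Primcodable G] [Primcodable A]
    {R : RepSystem G A} (hR : R.IsDecidable) :
    Computable₂ R.firstConsistent :=
  Computable.list_find? (f := fun q : ℕ × List (List A × Bool) => wordsUpTo G q.1)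
    (p := fun q r => R.consistent q.2 r) (primrec_wordsUpTo.to_comp.comp .fst)
    (hR.computable_consistent.comp (Computable.snd.comp .fst) .snd)

/-- The search cannot fail, since the target is itself a candidate. -/
theorem exists_firstConsistent (R : RepSystem G A) {s : ℕ} (r : R.reps)
    (hr : (r : List G).length ≤ s) (xs : List (List A)) :
    ∃ r' : R.reps, R.firstConsistent s (xs.map (R.label r)) = some (r' : List G) ∧
      (r' : List G).length ≤ s ∧ ∀ x ∈ xs, x ∈ R.concept r' ↔ x ∈ R.concept r := by
  cases h : R.firstConsistent s (xs.map (R.label r)) with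
  | none =>
    have := List.find?_eq_none.1 h r (mem_wordsUpTo.2 hr)
    simp [consistent_map_label] at this
  | some r' =>
    have h1 := consistent_map_label.1 (List.find?_some h)
    refine ⟨⟨r', h1.1⟩, rfl, mem_wordsUpTo.1 (List.mem_of_find?_eq_some h), fun x hx => ?_⟩
    rw [← classify_coe, ← classify_coe, h1.2 x hx]

variable [Finite A]

open Classical in
/-- The behaviours on examples of length at most `n` of the representations of length at most `s`,
listed without repetition. -/
noncomputable def behaviours (R : RepSystem G A) (n s : ℕ) : List (List (List A × Bool)) :=
  (wordsUpTo G s).foldl (fun l r =>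
    bif R.isRep r then (if R.fullSample n r ∈ l then l else l ++ [R.fullSample n r]) else l) []

open Classical in
theorem nodup_behaviours (R : RepSystem G A) (n s : ℕ) : (R.behaviours n s).Nodup := by
  unfold behaviours
  generalize wordsUpTo G s = ws
  suffices ∀ l : List (List (List A × Bool)), l.Nodup → (ws.foldl (fun l r => bif R.isRep r then
      (if R.fullSample n r ∈ l then l else l ++ [R.fullSample n r]) else l) l).Nodup from
    this [] List.nodup_nil
  induction ws with
  | nil => exact fun l hl => hl
  | cons r ws ih =>
    intro l hl
    refine ih _ ?_
    dsimp only
    cases R.isRep r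
    · exact hl
    · by_cases h : R.fullSample n r ∈ l
      · simpa only [h, if_true, cond_true] using hl
      · simpa only [h, if_false, cond_true] using
          List.nodup_append.2 ⟨hl, List.nodup_singleton _, fun a ha b hb hab => by
            rw [List.mem_singleton.1 hb] at hab
            exact h (hab ▸ ha)⟩

open Classical in
theorem mem_behaviours {R : RepSystem G A} {n s : ℕ} {t : List (List A × Bool)} :
    t ∈ R.behaviours n s ↔ ∃ r : R.reps, (r : List G).length ≤ s ∧ t = R.fullSample n r := by
  have key : ∀ (ws : List (List G)) (l : List (List (List A × Bool))),
      t ∈ (ws.foldl (fun l r => bif R.isRep r then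
        (if R.fullSample n r ∈ l then l else l ++ [R.fullSample n r]) else l) l) ↔
      t ∈ l ∨ ∃ r ∈ ws, r ∈ R.reps ∧ t = R.fullSample n r := by
    intro ws
    induction ws with
    | nil => simp
    | cons r ws ih =>
      intro l
      rw [List.foldl_cons, ih]
      cases h : R.isRep r
      · have : r ∉ R.reps := fun hr => by simp [isRep_iff.2 hr] at h
        simp [this]
      · have : r ∈ R.reps := isRep_iff.1 h
        by_cases hm : R.fullSample n r ∈ l
        · simp only [cond_true, hm, if_true, List.mem_cons, exists_eq_or_imp, this, true_and]
          constructor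
          · tauto
          · rintro (h | rfl | h) <;> tauto
        · simp [hm, this, or_assoc]
  have := key (wordsUpTo G s) []
  simp only [behaviours]
  rw [this]
  simp only [List.not_mem_nil, false_or, mem_wordsUpTo]
  constructor
  · rintro ⟨r, h1, h2, h3⟩
    exact ⟨⟨r, h2⟩, h1, h3⟩
  · rintro ⟨r, h1, h3⟩
    exact ⟨r, h1, r.2, h3⟩

/-- The first consistent representation is determined by its behaviour. -/
theorem firstConsistent_fullSample {R : RepSystem G A} {s n : ℕ} {sample : List (List A × Bool)}
    (hn : ∀ p ∈ sample, p.1.length ≤ n) {r : List G} (h : R.firstConsistent s sample = some r) :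
    R.firstConsistent s (R.fullSample n r) = some r := by
  unfold firstConsistent at h ⊢
  rw [List.find?_eq_some_iff_append] at h ⊢
  obtain ⟨h1, as, bs, h2, h3⟩ := h
  refine ⟨consistent_iff.2 ⟨(consistent_iff.1 h1).1, ?_⟩, as, bs, h2, fun a ha => ?_⟩
  · simp [fullSample]
  -- An earlier candidate consistent with all labels of `r` would in particular be consistent with
  -- the sample, against the choice of `r` as the first.
  · have := h3 a ha
    simp only [Bool.not_eq_true', Bool.eq_false_iff, ne_eq, consistent_iff, not_and] at this ⊢
    intro hr hc
    refine this hr fun p hp => ?_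
    rw [← (consistent_iff.1 h1).2 p hp]
    exact hc (p.1, R.classify r p.1) (List.mem_map_of_mem (mem_wordsUpTo.2 (hn p hp)))

variable [Primcodable G] [Primcodable A]

theorem IsDecidable.computable_behaviours {R : RepSystem G A} (hR : R.IsDecidable) :
    Computable₂ R.behaviours := by
  classical
  have hfull : Computable fun q : (ℕ × ℕ) × List (List (List A × Bool)) × List G =>
      R.fullSample q.1.1 q.2.2 :=
    hR.computable_fullSample.comp (Computable.fst.comp .fst) (Computable.snd.comp .snd)
  have h1 : Computable fun q : (ℕ × ℕ) × List (List (List A × Bool)) × List G =>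
      if R.fullSample q.1.1 q.2.2 ∈ q.2.1 then q.2.1 else q.2.1 ++ [R.fullSample q.1.1 q.2.2] :=
    (Computable.list_insert_last.comp (Computable.fst.comp .snd) hfull).of_eq
      fun q => by congr
  refine Computable₂.mk ((Computable.list_foldl (f := fun q : ℕ × ℕ => wordsUpTo G q.2)
    (g := fun _ => ([] : List (List (List A × Bool))))
    (h := fun q (p : List (List (List A × Bool)) × List G) => bif R.isRep p.2 then
      (if R.fullSample q.1 p.2 ∈ p.1 then p.1 else p.1 ++ [R.fullSample q.1 p.2]) else p.1)
    (primrec_wordsUpTo.to_comp.comp .snd) (Computable.const []) ?_).of_eq ?_)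
  · exact (Computable.cond (hR.computable_isRep.comp (Computable.snd.comp .snd)) h1
      (Computable.fst.comp .snd)).to₂
  · rintro ⟨n, s⟩
    simp only [behaviours]

end RepSystem

/-! ### Coding by an index of fixed length -/

/-- For each condition `y`, the entry of the list `F y` with a given index is a program of fixed
length. -/
theorem exists_condK_le_of_mem_list {Y X : Type*} [Primcodable Y] [Primcodable X]
    {U : List Bool × ℕ →. ℕ} (hU : IsOptimalPrefixMachine U) {F : Y → List X}
    (hF : Computable F) :
    ∃ C : ℕ, ∀ (y : Y) (x : X), x ∈ F y →
      condK U x y ≤ ((Nat.clog 2 (F y).length + C : ℕ) : ℕ∞) := by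
  -- At most one `k` satisfies this for a given `l`, namely `Nat.clog 2 l` if `l` is positive. Hence
  -- all halting programs for one condition have the same length, which makes the machine
  -- prefix-free.
  let fits : ℕ → ℕ → Bool := fun l k => decide (l ≤ 2 ^ k) && decide (2 ^ k < 2 * l)
  have hpow : Primrec fun k : ℕ => 2 ^ k := by
    refine (Primrec.nat_rec' (f := id) (g := fun _ => 1) (h := fun _ (p : ℕ × ℕ) => 2 * p.2)
      .id (Primrec.const 1) ?_).of_eq fun n => ?_
    · exact (Primrec.nat_mul.comp (Primrec.const 2) (Primrec.snd.comp .snd)).to₂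
    · induction n with
      | zero => rfl
      | succ n ih => simp only [id] at ih ⊢; rw [ih, pow_succ]; ring
  have hfits : Primrec₂ fits := by
    refine Primrec.and.comp ?_ ?_
    · exact PrimrecPred.decide (PrimrecRel.comp Primrec.nat_le .fst (hpow.comp .snd))
    · exact PrimrecPred.decide (PrimrecRel.comp Primrec.nat_lt (hpow.comp .snd)
        (Primrec.nat_mul.comp (Primrec.const 2) .fst))
  have fits_unique : ∀ l k k' : ℕ, k ≤ k' → fits l k → fits l k' → k = k' := by
    intro l k k' hk h h'
    simp only [fits, Bool.and_eq_true, decide_eq_true_eq] at h h'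
    by_contra hne
    have : 2 ^ (k + 1) ≤ 2 ^ k' := Nat.pow_le_pow_right (by norm_num) (by omega)
    rw [pow_succ] at this
    omega
  let run : List Bool × Y → Option X := fun q =>
    bif fits (F q.2).length q.1.length then (F q.2)[bitsVal q.1]? else none
  have hrun : Computable run := by
    have h1 : Computable fun q : List Bool × Y => F q.2 := hF.comp .snd
    exact Computable.cond (hfits.to_comp.comp (Computable.list_length.comp h1)
        (Computable.list_length.comp .fst))
      (Computable.list_getElem?.comp h1 (primrec_bitsVal.to_comp.comp .fst)) (Computable.const none)
  let M' : List Bool × ℕ → Option ℕ := fun q =>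
    (Encodable.decode (α := Y) q.2).bind fun y => (run (q.1, y)).map Encodable.encode
  have hM' : Computable M' := by
    refine Computable.option_bind (Computable.decode.comp .snd) ?_
    exact Computable₂.mk (Computable.option_map
      (hrun.comp ((Computable.fst.comp .fst).pair .snd)) (Computable.encode.comp .snd))
  let M : List Bool × ℕ →. ℕ := fun q => (M' q : Part ℕ)
  have hM : IsPrefixMachine M := by
    refine ⟨hM'.ofOption, fun y p q hpq hp hq => ?_⟩
    have key : ∀ p, (M (p, y)).Dom → ∃ z, Encodable.decode (α := Y) y = some z ∧
        fits (F z).length p.length := by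
      intro p hp
      simp only [M, Part.ofOption_dom, M', Option.isSome_bind] at hp
      cases hz : Encodable.decode (α := Y) y with
      | none => simp [hz] at hp
      | some z =>
        refine ⟨z, rfl, ?_⟩
        by_contra hf
        rw [Bool.not_eq_true] at hf
        simp [hz, run, hf] at hp
    obtain ⟨z, hz, hz1⟩ := key p hp
    obtain ⟨z', hz', hz2⟩ := key q hq
    obtain rfl : z = z' := by simpa [hz] using hz'
    exact hpq.eq_of_length (fits_unique _ _ _ hpq.length_le hz1 hz2)
  obtain ⟨C, hC⟩ := hU.2 M hM
  refine ⟨C, fun y x hx => ?_⟩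
  obtain ⟨j, hj, rfl⟩ := List.getElem_of_mem hx
  obtain ⟨p, hp, hv⟩ := exists_bitsVal_eq (Nat.clog 2 (F y).length) j
    (hj.trans_le (Nat.le_pow_clog one_lt_two _))
  have hfit : fits (F y).length p.length = true := by
    have hpos : 1 ≤ (F y).length := by omega
    simp only [fits, Bool.and_eq_true, decide_eq_true_eq, hp]
    refine ⟨Nat.le_pow_clog one_lt_two _, ?_⟩
    rcases hpos.eq_or_lt with h | h
    · simp [← h]
    · have h2 := Nat.pow_pred_clog_lt_self one_lt_two h
      have h3 : 0 < Nat.clog 2 (F y).length := Nat.clog_pos one_lt_two h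
      obtain ⟨k, hk⟩ := Nat.exists_eq_succ_of_ne_zero h3.ne'
      rw [hk] at h2 ⊢
      simp only [Nat.succ_eq_add_one, Nat.pred_succ, pow_succ] at h2 ⊢
      omega
  have hmem : Encodable.encode (F y)[j] ∈ M (p, Encodable.encode y) := by
    simp [M, M', run, hfit, hv, hj]
  obtain ⟨p', hp', hlen⟩ := hC p _ _ hmem
  refine (iInf₂_le p' hp').trans ?_
  exact_mod_cast hlen.trans (by omega)

/-! ### Runs on random examples -/

/-- A run depends only on the tokens it has read, so two streams that agree up to the first stop
give the same stop and the same output. This is how runs for different targets are compared. -/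
theorem TokenAlgorithm.Outputs.unique {ι τ o : Type*} {P : TokenAlgorithm ι τ o} {i : ι}
    {w w' : ℕ → τ} {t t' : ℕ} {y y' : o} (h : P.Outputs i w t y) (h' : P.Outputs i w' t' y')
    (hw : ∀ u < t, w u = w' u) : t = t' ∧ y = y' := by
  have hpre : ∀ u ≤ t, (List.range u).map w = (List.range u).map w' := fun u hu =>
    List.map_congr_left fun v hv => hw v ((List.mem_range.1 hv).trans_le hu)
  rcases lt_trichotomy t t' with hlt | rfl | hlt
  · have h1 := h.2
    rw [hpre t le_rfl] at h1
    exact absurd (Part.mem_unique h1 (h'.1 t hlt)) (by simp)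
  · have h1 := h.2
    rw [hpre t le_rfl] at h1
    exact ⟨rfl, Option.some_injective _ (Part.mem_unique h1 h'.2)⟩
  · have h1 := h.1 t' hlt
    rw [hpre t' hlt.le] at h1
    exact absurd (Part.mem_unique h1 h'.2) (by simp)

section ExampleMeasure

variable {A : Type*}

instance (D : PMF (List A)) : IsProbabilityMeasure (exampleMeasure D) := by
  unfold exampleMeasure; infer_instance

theorem exampleMeasure_apply_eval (D : PMF (List A)) (i : ℕ) (S : Set (List A)) :
    exampleMeasure D {w | w i ∈ S} = D.toMeasure S := by
  have h := Measure.infinitePi_map_eval (fun _ : ℕ => D.toMeasure) i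
  conv_rhs => rw [← h]
  rw [Measure.map_apply (measurable_pi_apply i) MeasurableSpace.measurableSet_top]
  rfl

/-- The sample size bound concerns streams all of whose examples are short; a random stream has this
property only almost surely. -/
theorem exampleMeasure_exists_notMem_support (D : PMF (List A)) :
    exampleMeasure D {w | ∃ i, w i ∉ D.support} = 0 := by
  have : {w : ℕ → List A | ∃ i, w i ∉ D.support} = ⋃ i, {w | w i ∈ D.supportᶜ} := by
    ext w; simp
  rw [this, measure_iUnion_null_iff]
  intro i
  rw [exampleMeasure_apply_eval, PMF.toMeasure_apply_eq_zero_iff _ MeasurableSpace.measurableSet_top]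
  exact disjoint_compl_right

/-- The event depends on finitely many coordinates, which range over a countable discrete space. -/
theorem measurableSet_outputs [Countable A] {ι τ o : Type*} (P : TokenAlgorithm ι τ o) (i : ι)
    (f : List A → τ) (t : ℕ) (y : o) :
    MeasurableSet {w : ℕ → List A | P.Outputs i (fun j => f (w j)) t y} := by
  have key : ∀ (u : ℕ) (z : Option o),
      MeasurableSet {w : ℕ → List A | z ∈ P (i, (List.range u).map fun j => f (w j))} := by
    intro u z
    have : DiscreteMeasurableSpace (List A) := ⟨fun _ => MeasurableSpace.measurableSet_top⟩
    have hm : Measurable fun (w : ℕ → List A) (j : Fin u) => w j :=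
      measurable_pi_lambda _ fun j => measurable_pi_apply _
    have := hm (MeasurableSet.of_discrete
      (s := {v : Fin u → List A | z ∈ P (i, List.ofFn fun j => f (v j))}))
    convert this using 1
    ext w
    simp only [mem_ofPred_eq, mem_preimage]
    rw [List.ofFn_eq_map, ← List.map_coe_finRange_eq_range, List.map_map]
    rfl
  have : {w : ℕ → List A | P.Outputs i (fun j => f (w j)) t y} =
      (⋂ u ∈ Finset.range t, {w | none ∈ P (i, (List.range u).map fun j => f (w j))}) ∩
        {w | some y ∈ P (i, (List.range t).map fun j => f (w j))} := by
    ext w; simp [TokenAlgorithm.Outputs]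
  rw [this]
  exact (Finset.measurableSet_biInter _ fun u _ => key u none).inter (key t (some y))

end ExampleMeasure

/-! ### Lower bounds for the sample size -/

theorem fracVal_one_two_mul (n : ℕ) : fracVal (1, 2 * n) = 1 / (2 * (n : ℝ)) := by
  simp [fracVal]

section LowerBounds

variable {G A : Type*} [Primcodable G] [Primcodable A] {R : RepSystem G A}
  {L : TokenAlgorithm (ℕ × ℕ × (ℕ × ℕ) × (ℕ × ℕ)) (List A × Bool) (List G)}
  {mL : ℕ → ℕ → ℝ → ℝ → ℝ}

/-- If two targets agree on one example but differ on another one, then a learner of accuracy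
`1 / (2n)` needs a number of examples proportional to `n`. -/
theorem mul_le_sampleSize_of_agree_of_differ (hL : IsDeterministicPac R L)
    (hmL : HasSampleSize R L mL) {s n : ℕ} (hs : 1 ≤ s) (hn : 1 ≤ n) {δ : ℕ × ℕ}
    (hδ : 0 < fracVal δ) {r₁ r₂ : R.reps} (h₁ : (r₁ : List G).length ≤ s)
    (h₂ : (r₂ : List G).length ≤ s) {x z : List A} (hx : x.length ≤ n) (hz : z.length ≤ n)
    (hagree : z ∈ R.concept r₁ ↔ z ∈ R.concept r₂)
    (hdiffer : ¬(x ∈ R.concept r₁ ↔ x ∈ R.concept r₂)) :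
    n * (1 - fracVal δ) ≤ mL n s (1 / (2 * n)) (fracVal δ) := by
  have hn0 : (0 : ℝ) < n := by exact_mod_cast hn
  have hε : 0 < fracVal (1, 2 * n) := by rw [fracVal_one_two_mul]; positivity
  have : NeZero n := ⟨by omega⟩
  have : DiscreteMeasurableSpace (List A) := ⟨fun _ => MeasurableSpace.measurableSet_top⟩
  have hxz : x ≠ z := by rintro rfl; exact hdiffer hagree
  -- Mass `1 / n` at `x` and the rest at `z`: an error at `x` is already twice the permitted `1 /
  -- (2n)`.
  let D : PMF (List A) := (PMF.uniformOfFintype (Fin n)).map fun i => if i = 0 then x else z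
  have hDapp : ∀ S : Set (List A), D.toMeasure S =
      (PMF.uniformOfFintype (Fin n)).toMeasure ((fun i => if i = 0 then x else z) ⁻¹' S) :=
    fun S => PMF.toMeasure_map_apply _ _ _ .of_discrete .of_discrete
  have hDx : D.toMeasure {x} = (n : ℝ≥0∞)⁻¹ := by
    have : (fun i : Fin n => if i = 0 then x else z) ⁻¹' {x} = {0} := by
      ext i; by_cases h : i = 0 <;> simp [h, hxz.symm]
    rw [hDapp, this, PMF.toMeasure_apply_singleton _ _ .of_discrete]
    simp
  have hDz : D.toMeasure {z}ᶜ = (n : ℝ≥0∞)⁻¹ := by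
    have : (fun i : Fin n => if i = 0 then x else z) ⁻¹' {z}ᶜ = {0} := by
      ext i; by_cases h : i = 0 <;> simp [h, hxz]
    rw [hDapp, this, PMF.toMeasure_apply_singleton _ _ .of_discrete]
    simp
  have hDsupp : ∀ y ∈ D.support, y.length ≤ n := by
    intro y hy
    obtain ⟨i, -, rfl⟩ := (PMF.mem_support_map_iff _ _ _).1 hy
    split_ifs <;> assumption
  -- If only `z` is ever drawn, the two targets look alike to the learner, and its single output `y`
  -- is wrong at `x` for one of them.
  obtain ⟨t, y, ht, htm⟩ := hmL s n hs hn (1, 2 * n) δ hε hδ r₁ h₁ (fun _ => z) fun _ => hz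
  rw [fracVal_one_two_mul] at htm
  have hwrong : ∃ r : R.reps, (r : List G).length ≤ s ∧ R.label r z = R.label r₁ z ∧
      ∀ r' : R.reps, (r' : List G) = y → x ∈ symmDiff (R.concept r') (R.concept r) := by
    by_cases hy : y ∈ R.reps
    · have hr' : ∀ r' : R.reps, (r' : List G) = y → r' = ⟨y, hy⟩ := fun r' h => Subtype.ext h
      by_cases h : x ∈ R.concept ⟨y, hy⟩ ↔ x ∈ R.concept r₁
      · refine ⟨r₂, h₂, by simp [RepSystem.label, hagree], fun r' e => ?_⟩
        rw [hr' r' e, Set.mem_symmDiff]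
        tauto
      · refine ⟨r₁, h₁, rfl, fun r' e => ?_⟩
        rw [hr' r' e, Set.mem_symmDiff]
        tauto
    · exact ⟨r₁, h₁, rfl, fun r' e => absurd (e ▸ r'.2) hy⟩
  obtain ⟨r, hr, hlab, hbad⟩ := hwrong
  have hpac := hL.2 s n hs hn (1, 2 * n) δ hε hδ r hr D hDsupp
  -- Success on the fooling target needs a draw other than `z` among the first `t`; by the union
  -- bound this has probability at most `t / n`.
  have hsub : {w : ℕ → List A | ∃ (t : ℕ) (r' : R.reps),
      L.Outputs (s, n, (1, 2 * n), δ) (fun i => R.label r (w i)) t (r' : List G) ∧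
      D.toMeasure (symmDiff (R.concept r') (R.concept r)) ≤
        ENNReal.ofReal (fracVal (1, 2 * n))} ⊆ ⋃ i ∈ Finset.range t, {w | w i ∈ ({z}ᶜ : Set _)} := by
    rintro w ⟨t', r', hout, herr⟩
    by_contra hw
    simp only [mem_iUnion, Finset.mem_range, mem_ofPred_eq, mem_compl_iff, mem_singleton_iff,
      exists_prop, not_exists, not_and, not_not] at hw
    have heq := ht.unique hout fun u hu => by rw [hw u hu, hlab]
    have h1 := (measure_mono (μ := D.toMeasure)
      (singleton_subset_iff.2 (hbad r' heq.2.symm))).trans herr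
    rw [hDx, fracVal_one_two_mul, ← ENNReal.ofReal_natCast, ← ENNReal.ofReal_inv_of_pos hn0,
      ENNReal.ofReal_le_ofReal_iff (by positivity), one_div, mul_inv] at h1
    have : (0 : ℝ) < (n : ℝ)⁻¹ := by positivity
    linarith
  have hmeas := hpac.trans ((measure_mono hsub).trans (measure_biUnion_finset_le _ _))
  simp only [exampleMeasure_apply_eval, hDz, Finset.sum_const, Finset.card_range,
    nsmul_eq_mul] at hmeas
  rw [← ENNReal.ofReal_natCast, ← ENNReal.ofReal_natCast, ← ENNReal.ofReal_inv_of_pos hn0,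
    ← ENNReal.ofReal_mul (by positivity), ENNReal.ofReal_le_ofReal_iff (by positivity)] at hmeas
  calc n * (1 - fracVal δ) ≤ n * (t * (n : ℝ)⁻¹) := by gcongr
    _ = t := by field_simp
    _ ≤ _ := htm

/-- The number of targets on a shattered set for which the same sequence of examples can be used
is bounded in terms of the labels of the sequence and of the set of misclassified examples. -/
theorem two_pow_card_le_of_shattered (hL : IsDeterministicPac R L)
    (hmL : HasSampleSize R L mL) {s n : ℕ} (hs : 1 ≤ s) (hn : 1 ≤ n) {δ : ℕ × ℕ}
    (hδ : 0 < fracVal δ) {X : Finset (List A)} (hX : X.Nonempty) (hlen : ∀ x ∈ X, x.length ≤ n)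
    (hsh : ∀ T ⊆ X, ∃ r : R.reps, (r : List G).length ≤ s ∧
      ∀ x ∈ X, x ∈ R.concept r ↔ x ∈ T) :
    (1 - fracVal δ) * 2 ^ X.card ≤ 2 ^ ⌊mL n s (1 / (2 * n)) (fracVal δ)⌋₊ *
      ((X.powerset.filter fun E => 2 * n * E.card ≤ X.card).card : ℝ) := by
  classical
  set q := ⌊mL n s (1 / (2 * n)) (fracVal δ)⌋₊ with hq
  set Es := X.powerset.filter fun E => 2 * n * E.card ≤ X.card with hEs
  have hn0 : (0 : ℝ) < n := by exact_mod_cast hn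
  have hε : 0 < fracVal (1, 2 * n) := by rw [fracVal_one_two_mul]; positivity
  let D : PMF (List A) := PMF.uniformOfFinset X hX
  have hD : D.support = X := PMF.support_uniformOfFinset hX
  have : Nonempty R.reps := ⟨(hsh ∅ (Finset.empty_subset _)).choose⟩
  choose! ρ hρs hρ using hsh
  -- The restriction to `t ≤ q` ensures that `q` labels determine the whole run.
  let good : Finset (List A) → Set (ℕ → List A) := fun T => {w | ∃ t ≤ q, ∃ r' : R.reps,
    L.Outputs (s, n, (1, 2 * n), δ) (fun i => R.label (ρ T) (w i)) t (r' : List G) ∧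
    D.toMeasure (symmDiff (R.concept r') (R.concept (ρ T))) ≤
      ENNReal.ofReal (fracVal (1, 2 * n))}
  have hmeas : ∀ T, MeasurableSet (good T) := by
    intro T
    have : good T = ⋃ (t : ℕ) (_ : t ≤ q) (r' : R.reps)
        (_ : D.toMeasure (symmDiff (R.concept r') (R.concept (ρ T))) ≤
          ENNReal.ofReal (fracVal (1, 2 * n))),
        {w | L.Outputs (s, n, (1, 2 * n), δ) (fun i => R.label (ρ T) (w i)) t (r' : List G)} := by
      ext w
      simp only [good, mem_ofPred_eq, mem_iUnion, exists_prop]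
      simp only [and_comm]
    rw [this]
    exact .iUnion fun t => .iUnion fun _ => .iUnion fun r' => .iUnion fun _ =>
      measurableSet_outputs _ _ _ _ _
  have hgood : ∀ T ∈ X.powerset,
      ENNReal.ofReal (1 - fracVal δ) ≤ exampleMeasure D (good T) := by
    intro T hT
    rw [Finset.mem_powerset] at hT
    refine (hL.2 s n hs hn (1, 2 * n) δ hε hδ (ρ T) (hρs T hT) D
      (fun x hx => hlen x (by simpa [hD] using hx))).trans ?_
    rw [← add_zero (exampleMeasure D (good T)), ← exampleMeasure_exists_notMem_support D]
    refine (measure_mono ?_).trans (measure_union_le _ _)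
    rintro w ⟨t, r', hout, herr⟩
    by_cases hw : ∃ i, w i ∉ D.support
    · exact Or.inr hw
    · simp only [not_exists, not_not, hD, Finset.mem_coe] at hw
      obtain ⟨t', y, hout', ht'⟩ := hmL s n hs hn (1, 2 * n) δ hε hδ (ρ T) (hρs T hT) w
        fun i => hlen _ (hw i)
      rw [fracVal_one_two_mul] at ht'
      obtain ⟨rfl, -⟩ := hout.unique hout' fun _ _ => rfl
      exact Or.inl ⟨t, Nat.le_floor ht', r', hout, herr⟩
  have hcount : ∀ w, (X.powerset.filter fun T => w ∈ good T).card ≤ 2 ^ q * Es.card := by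
    intro w
    have hex : ∀ T, w ∈ good T → ∃ r' : R.reps, ∃ t ≤ q,
        L.Outputs (s, n, (1, 2 * n), δ) (fun i => R.label (ρ T) (w i)) t (r' : List G) ∧
        D.toMeasure (symmDiff (R.concept r') (R.concept (ρ T))) ≤
          ENNReal.ofReal (fracVal (1, 2 * n)) := by
      rintro T ⟨t, ht, r', h⟩
      exact ⟨r', t, ht, h⟩
    choose! out len hlen hout herr using hex
    -- The labels determine the output, and correcting the output on its error set gives back `T`;
    -- so the code is injective on successful targets.
    let code : Finset (List A) → (Fin q → Bool) × Finset (List A) := fun T =>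
      (fun i => (R.label (ρ T) (w i)).2,
        X.filter fun x => x ∈ symmDiff (R.concept (out T)) (R.concept (ρ T)))
    have hmaps : ∀ T ∈ X.powerset.filter fun T => w ∈ good T,
        code T ∈ (Finset.univ : Finset (Fin q → Bool)) ×ˢ Es := by
      intro T hT
      have h := herr T (Finset.mem_filter.1 hT).2
      simp only [D] at h
      rw [PMF.toMeasure_uniformOfFinset_apply _ _ MeasurableSpace.measurableSet_top,
        fracVal_one_two_mul] at h
      have hX0 : (0 : ℝ) < X.card := by exact_mod_cast hX.card_pos
      rw [← ENNReal.ofReal_natCast, ← ENNReal.ofReal_natCast, ← ENNReal.ofReal_div_of_pos hX0,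
        ENNReal.ofReal_le_ofReal_iff (by positivity), div_le_div_iff₀ hX0 (by positivity)] at h
      simp only [code, Finset.mem_product, Finset.mem_univ, true_and, hEs, Finset.mem_filter,
        Finset.mem_powerset, Finset.filter_subset]
      have h' : (2 * n * (X.filter fun x =>
          x ∈ symmDiff (R.concept (out T)) (R.concept (ρ T))).card : ℝ) ≤ X.card := by
        linarith
      exact_mod_cast h'
    have hinj : Set.InjOn code (X.powerset.filter fun T => w ∈ good T) := by
      intro T hT T' hT' heq
      simp only [Finset.coe_filter, Finset.mem_powerset, mem_ofPred_eq] at hT hT'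
      have hlabel : ∀ u < len T, R.label (ρ T) (w u) = R.label (ρ T') (w u) := by
        intro u hu
        have := congrFun (congrArg Prod.fst heq) ⟨u, hu.trans_le (hlen T hT.2)⟩
        exact Prod.ext rfl this
      have hr : out T = out T' :=
        Subtype.ext ((hout T hT.2).unique (hout T' hT'.2) hlabel).2
      have hE : (X.filter fun x => x ∈ symmDiff (R.concept (out T)) (R.concept (ρ T))) =
          X.filter fun x => x ∈ symmDiff (R.concept (out T')) (R.concept (ρ T')) :=
        congrArg Prod.snd heq
      ext x
      by_cases hx : x ∈ X
      · have h1 := Finset.ext_iff.1 hE x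
        simp only [Finset.mem_filter, hx, true_and, Set.mem_symmDiff, hr, hρ T hT.1 x hx,
          hρ T' hT'.1 x hx] at h1
        tauto
      · exact ⟨fun h => absurd (hT.1 h) hx, fun h => absurd (hT'.1 h) hx⟩
    refine (Finset.card_le_card_of_injOn code hmaps hinj).trans ?_
    simp [Finset.card_product]
  -- Double counting of pairs of a target and a stream: each target succeeds with probability at
  -- least `1 - δ`, and each stream serves at most `2 ^ q * Es.card` targets.
  have hsum : (2 ^ X.card : ℝ≥0∞) * ENNReal.ofReal (1 - fracVal δ) ≤ 2 ^ q * Es.card := by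
    calc (2 ^ X.card : ℝ≥0∞) * ENNReal.ofReal (1 - fracVal δ)
        = ∑ _T ∈ X.powerset, ENNReal.ofReal (1 - fracVal δ) := by
          simp [Finset.card_powerset]
      _ ≤ ∑ T ∈ X.powerset, exampleMeasure D (good T) := Finset.sum_le_sum hgood
      _ = ∫⁻ w, ∑ T ∈ X.powerset, (good T).indicator 1 w ∂exampleMeasure D := by
          rw [lintegral_finsetSum _ fun T _ => measurable_one.indicator (hmeas T)]
          exact Finset.sum_congr rfl fun T _ => (lintegral_indicator_one (hmeas T)).symm
      _ ≤ ∫⁻ _, 2 ^ q * (Es.card : ℝ≥0∞) ∂exampleMeasure D := by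
          refine lintegral_mono fun w => ?_
          have h : ∑ T ∈ X.powerset, (good T).indicator (1 : (ℕ → List A) → ℝ≥0∞) w =
              ((X.powerset.filter fun T => w ∈ good T).card : ℝ≥0∞) := by
            rw [Finset.card_filter, Nat.cast_sum]
            refine Finset.sum_congr rfl fun T _ => ?_
            by_cases hw : w ∈ good T <;> simp [hw]
          rw [h]
          refine (Nat.cast_le.2 (hcount w)).trans_eq ?_
          push_cast
          rfl
      _ = 2 ^ q * Es.card := by simp
  by_cases h1 : 0 ≤ 1 - fracVal δ
  · have h2 := ENNReal.toReal_mono (by finiteness) hsum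
    simp only [ENNReal.toReal_mul, ENNReal.toReal_pow, ENNReal.toReal_ofNat,
      ENNReal.toReal_natCast, ENNReal.toReal_ofReal h1] at h2
    linarith
  · refine (mul_nonpos_of_nonpos_of_nonneg (by linarith) (by positivity)).trans (by positivity)

end LowerBounds

/-! ### The number of behaviours -/

/-- Sauer-Shelah: a family of subsets of `W` that shatters only sets of size at most `d` has at most
`(|W| + 1) ^ d` members. -/
theorem Finset.card_le_pow_of_shatters {α : Type*} [DecidableEq α] {𝒜 : Finset (Finset α)}
    {W : Finset α} {d : ℕ} (hW : ∀ S ∈ 𝒜, S ⊆ W)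
    (hd : ∀ X : Finset α, 𝒜.Shatters X → X.card ≤ d) : 𝒜.card ≤ (W.card + 1) ^ d := by
  have hsub : 𝒜.shatterer ⊆ (Finset.range (d + 1)).biUnion fun k => W.powersetCard k := by
    intro X hX
    rw [Finset.mem_shatterer] at hX
    obtain ⟨S, hS, hXS⟩ := hX.exists_superset
    simp only [Finset.mem_biUnion, Finset.mem_range, Finset.mem_powersetCard]
    exact ⟨X.card, Nat.lt_succ_of_le (hd X hX), hXS.trans (hW S hS), rfl⟩
  calc 𝒜.card ≤ 𝒜.shatterer.card := Finset.card_le_card_shatterer 𝒜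
    _ ≤ ∑ k ∈ Finset.range (d + 1), (W.powersetCard k).card :=
      (Finset.card_le_card hsub).trans Finset.card_biUnion_le
    -- The factors `d.choose k`, all at least 1, are inserted to make the sum a binomial expansion.
    _ ≤ ∑ k ∈ Finset.range (d + 1), W.card ^ k * 1 ^ (d - k) * d.choose k := by
      refine Finset.sum_le_sum fun k hk => ?_
      rw [Finset.card_powersetCard, one_pow, mul_one]
      exact (Nat.choose_le_pow _ _).trans
        (Nat.le_mul_of_pos_right _ (Nat.choose_pos (Finset.mem_range_succ_iff.1 hk)))
    _ = (W.card + 1) ^ d := (add_pow _ _ _).symm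

/-- A set has few subsets of relative size at most `1/48`. -/
theorem card_filter_powerset_le {α : Type*} (X : Finset α) {n : ℕ} (hn : 24 ≤ n) :
    ((X.powerset.filter fun E => 2 * n * E.card ≤ X.card).card : ℝ) ≤ 2 ^ ((X.card : ℝ) / 4) := by
  set d := X.card with hd
  -- A Chernoff-type weighting: the total weight is `(9 / 8) ^ d`, while a set with at most `d / 48`
  -- elements weighs at least `2 ^ (-d / 16)`.
  have h1 : ∑ E ∈ X.powerset, (1 / 8 : ℝ) ^ E.card = (9 / 8) ^ d := by
    have := Finset.sum_pow_mul_eq_add_pow (1 / 8 : ℝ) 1 X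
    simp only [one_pow, mul_one] at this
    rw [this, hd]; norm_num
  have h2 : ∀ E ∈ X.powerset.filter fun E => 2 * n * E.card ≤ d,
      (2 : ℝ) ^ (-(d : ℝ) / 16) ≤ (1 / 8 : ℝ) ^ E.card := by
    intro E hE
    have h48 : 48 * E.card ≤ d :=
      (Nat.mul_le_mul_right _ (by omega)).trans (Finset.mem_filter.1 hE).2
    have h48' : (48 * E.card : ℝ) ≤ d := by exact_mod_cast h48
    have h8 : (1 / 8 : ℝ) = 2 ^ (-3 : ℝ) := by
      rw [Real.rpow_neg (by norm_num)]; norm_num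
    rw [h8, ← Real.rpow_natCast, ← Real.rpow_mul (by norm_num)]
    exact Real.rpow_le_rpow_of_exponent_le (by norm_num) (by linarith)
  -- This is `(9 / 8) ^ 16 ≤ 8`, with 16th roots taken.
  have h3 : (9 / 8 : ℝ) ≤ 2 ^ (3 / 16 : ℝ) := by
    have : ((9 / 8 : ℝ) ^ (16 : ℕ)) ^ (1 / 16 : ℝ) ≤ ((2 : ℝ) ^ (3 : ℕ)) ^ (1 / 16 : ℝ) :=
      Real.rpow_le_rpow (by positivity) (by norm_num) (by norm_num)
    rw [← Real.rpow_natCast, ← Real.rpow_natCast, ← Real.rpow_mul (by norm_num),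
      ← Real.rpow_mul (by norm_num)] at this
    norm_num at this ⊢
    exact this
  have h4 : ((X.powerset.filter fun E => 2 * n * E.card ≤ d).card : ℝ) * 2 ^ (-(d : ℝ) / 16) ≤
      2 ^ (3 * (d : ℝ) / 16) := by
    calc _ = ∑ _E ∈ X.powerset.filter fun E => 2 * n * E.card ≤ d, (2 : ℝ) ^ (-(d : ℝ) / 16) := by
          simp
      _ ≤ ∑ E ∈ X.powerset.filter fun E => 2 * n * E.card ≤ d, (1 / 8 : ℝ) ^ E.card :=
          Finset.sum_le_sum h2
      _ ≤ ∑ E ∈ X.powerset, (1 / 8 : ℝ) ^ E.card :=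
          Finset.sum_le_sum_of_subset_of_nonneg (Finset.filter_subset _ _)
            fun _ _ _ => by positivity
      _ = (9 / 8) ^ d := h1
      _ ≤ (2 ^ (3 / 16 : ℝ)) ^ d := by gcongr
      _ = 2 ^ (3 * (d : ℝ) / 16) := by
          rw [← Real.rpow_natCast, ← Real.rpow_mul (by norm_num)]
          congr 1; ring
  rw [neg_div, Real.rpow_neg (by norm_num), ← div_eq_mul_inv, div_le_iff₀ (by positivity),
    ← Real.rpow_add (by norm_num)] at h4
  rwa [show (d : ℝ) / 4 = 3 * d / 16 + d / 16 by ring]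

open Classical in
/-- The traces of the concepts of representations of length at most `s` on the examples of length at
most `n`. -/
noncomputable def RepSystem.traces {G A : Type*} [Finite A] (R : RepSystem G A) (n s : ℕ) :
    Finset (Finset (List A)) :=
  (wordsUpTo A n).toFinset.powerset.filter fun S =>
    ∃ r : R.reps, (r : List G).length ≤ s ∧ ∀ x : List A, x.length ≤ n →
      (x ∈ R.concept r ↔ x ∈ S)

theorem RepSystem.mem_traces {G A : Type*} [Finite A] {R : RepSystem G A} {n s : ℕ}
    {S : Finset (List A)} : S ∈ R.traces n s ↔ (∀ x ∈ S, x.length ≤ n) ∧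
      ∃ r : R.reps, (r : List G).length ≤ s ∧ ∀ x : List A, x.length ≤ n →
        (x ∈ R.concept r ↔ x ∈ S) := by
  simp [RepSystem.traces, Finset.subset_iff, mem_wordsUpTo]

/-- Each behaviour is the table of a trace, and absence of repetition turns the length of the list
into a cardinality. -/
theorem RepSystem.length_behaviours_le {G A : Type*} [Finite G] [Finite A] (R : RepSystem G A)
    (n s : ℕ) : (R.behaviours n s).length ≤ (R.traces n s).card := by
  classical
  rw [← List.toFinset_card_of_nodup (R.nodup_behaviours n s)]
  have : (R.behaviours n s).toFinset ⊆ (R.traces n s).image fun S =>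
      (wordsUpTo A n).map fun x => (x, decide (x ∈ S)) := by
    intro t ht
    obtain ⟨r, hr, rfl⟩ := mem_behaviours.1 (List.mem_toFinset.1 ht)
    rw [Finset.mem_image]
    refine ⟨(wordsUpTo A n).toFinset.filter (· ∈ R.concept r), mem_traces.2 ⟨?_, r, hr, ?_⟩, ?_⟩
    · simp +contextual [mem_wordsUpTo]
    · simp +contextual [mem_wordsUpTo]
    · refine List.map_congr_left fun x hx => ?_
      by_cases h : x ∈ R.concept r <;> simp [h, hx, classify]
  exact (Finset.card_le_card this).trans Finset.card_image_le

theorem sampleSize_nonneg {G A : Type*} {R : RepSystem G A}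
    {L : TokenAlgorithm (ℕ × ℕ × (ℕ × ℕ) × (ℕ × ℕ)) (List A × Bool) (List G)}
    {mL : ℕ → ℕ → ℝ → ℝ → ℝ} {s n : ℕ} {δ : ℕ × ℕ} (hmL : HasSampleSize R L mL)
    (hs : 1 ≤ s) (hn : 1 ≤ n) (hδ : 0 < fracVal δ) (r : R.reps) (hr : (r : List G).length ≤ s) :
    0 ≤ mL n s (1 / (2 * n)) (fracVal δ) := by
  have hε : 0 < fracVal (1, 2 * n) := by
    have : (0 : ℝ) < n := by exact_mod_cast hn
    rw [fracVal_one_two_mul]; positivity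
  obtain ⟨t, -, -, ht⟩ := hmL s n hs hn (1, 2 * n) δ hε hδ r hr (fun _ => []) fun _ => by simp
  rw [fracVal_one_two_mul] at ht
  exact (Nat.cast_nonneg t).trans ht

theorem two_rpow_bitsPerSymbol {A : Type*} :
    (2 : ℝ) ^ bitsPerSymbol A = (max 2 (Nat.card A) : ℕ) := by
  have h : bitsPerSymbol A = Real.logb 2 (max 2 (Nat.card A) : ℕ) := by
    unfold bitsPerSymbol
    rcases le_total 2 (Nat.card A) with h | h
    · rw [max_eq_right h, max_eq_right]
      rw [← Real.logb_self_eq_one (b := 2) (by norm_num)]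
      exact Real.logb_le_logb_of_le (by norm_num) (by norm_num) (by exact_mod_cast h)
    · rw [max_eq_left h, max_eq_left]
      · norm_num
      · rcases Nat.eq_zero_or_pos (Nat.card A) with h0 | h0
        · simp [h0]
        · rw [← Real.logb_self_eq_one (b := 2) (by norm_num)]
          exact Real.logb_le_logb_of_le (by norm_num) (by exact_mod_cast h0) (by exact_mod_cast h)
  rw [h, Real.rpow_logb (by norm_num) (by norm_num)]
  positivity

theorem one_le_bitsPerSymbol {A : Type*} : 1 ≤ bitsPerSymbol A := le_max_left _ _

theorem card_traces_le_two_rpow {G A : Type*} [Finite A] [DecidableEq (List A)]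
    {R : RepSystem G A} (n s : ℕ) {d : ℕ}
    (hd : ∀ X : Finset (List A), (R.traces n s).Shatters X → X.card ≤ d) :
    ((R.traces n s).card : ℝ) ≤ 2 ^ ((d : ℝ) * (n * bitsPerSymbol A + 1)) := by
  have h1 : (R.traces n s).card ≤ ((wordsUpTo A n).toFinset.card + 1) ^ d :=
    Finset.card_le_pow_of_shatters (fun S hS x hx =>
      List.mem_toFinset.2 (mem_wordsUpTo.2 ((RepSystem.mem_traces.1 hS).1 x hx))) hd
  have h2 : (wordsUpTo A n).toFinset.card + 1 ≤ 2 * max 2 (Nat.card A) ^ n :=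
    (Nat.succ_le_succ (List.toFinset_card_le _)).trans (length_wordsUpTo_lt n)
  have h3 : (2 : ℝ) ^ ((d : ℝ) * (n * bitsPerSymbol A + 1)) =
      (2 * (max 2 (Nat.card A) : ℕ) ^ n) ^ d := by
    rw [mul_comm (d : ℝ), Real.rpow_mul (by norm_num), Real.rpow_natCast,
      Real.rpow_add (by norm_num), Real.rpow_one, mul_comm (n : ℝ), Real.rpow_mul (by norm_num),
      Real.rpow_natCast, two_rpow_bitsPerSymbol, mul_comm]
  rw [h3]
  exact_mod_cast h1.trans (Nat.pow_le_pow_left h2 d)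

theorem card_traces_le_two_pow {G A : Type*} [Finite A] (R : RepSystem G A) (n s : ℕ) :
    (R.traces n s).card ≤ 2 ^ (wordsUpTo A n).length := by
  classical
  unfold RepSystem.traces
  refine (Finset.card_filter_le _ _).trans ?_
  rw [Finset.card_powerset]
  exact Nat.pow_le_pow_right (by norm_num) (List.toFinset_card_le _)

theorem length_wordsUpTo_le_of_le {A : Type*} [Finite A] {n k : ℕ} (h : n ≤ k) :
    (wordsUpTo A n).length ≤ 2 * max 2 (Nat.card A) ^ k := by
  have h1 := length_wordsUpTo_lt (G := A) n
  have h2 : max 2 (Nat.card A) ^ n ≤ max 2 (Nat.card A) ^ k :=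
    Nat.pow_le_pow_right (by omega) h
  omega

/-! ### From the sample size to the number of traces -/

section TraceBounds

variable {G A : Type*} [Finite A] [Primcodable G] [Primcodable A] {R : RepSystem G A}
  {L : TokenAlgorithm (ℕ × ℕ × (ℕ × ℕ) × (ℕ × ℕ)) (List A × Bool) (List G)}
  {mL : ℕ → ℕ → ℝ → ℝ → ℝ} {s n : ℕ} {δ : ℕ × ℕ}

/-- If the bound failed, no two distinct traces could agree on any word, so distinct traces would be
complementary. Three sets cannot be pairwise complementary, as the empty word already shows. -/
theorem mul_le_sampleSize_of_two_lt_card_traces (hL : IsDeterministicPac R L)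
    (hmL : HasSampleSize R L mL) (hs : 1 ≤ s) (hn : 1 ≤ n) (hδ : 0 < fracVal δ)
    (hcard : 2 < (R.traces n s).card) :
    n * (1 - fracVal δ) ≤ mL n s (1 / (2 * n)) (fracVal δ) := by
  by_contra hlt
  have hcompl : ∀ S ∈ R.traces n s, ∀ T ∈ R.traces n s, S ≠ T →
      ∀ z : List A, z.length ≤ n → (z ∈ S ↔ z ∉ T) := by
    intro S hS T hT hne z hz
    obtain ⟨hS1, r₁, h₁, hr₁⟩ := RepSystem.mem_traces.1 hS
    obtain ⟨hT1, r₂, h₂, hr₂⟩ := RepSystem.mem_traces.1 hT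
    by_contra hz'
    have hx : ∃ x : List A, x.length ≤ n ∧ ¬(x ∈ S ↔ x ∈ T) := by
      by_contra! hx
      refine hne (Finset.ext fun x => ⟨fun h => ?_, fun h => ?_⟩)
      · exact (hx x (hS1 x h)).1 h
      · exact (hx x (hT1 x h)).2 h
    obtain ⟨x, hx, hxne⟩ := hx
    refine hlt (mul_le_sampleSize_of_agree_of_differ hL hmL hs hn hδ h₁ h₂ hx hz ?_ ?_)
    · rw [hr₁ z hz, hr₂ z hz]; tauto
    · rwa [hr₁ x hx, hr₂ x hx]
  obtain ⟨S₁, h₁, S₂, h₂, S₃, h₃, h12, h13, h23⟩ := Finset.two_lt_card.1 hcard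
  have e12 := hcompl _ h₁ _ h₂ h12 [] (by simp)
  have e13 := hcompl _ h₁ _ h₃ h13 [] (by simp)
  have e23 := hcompl _ h₂ _ h₃ h23 [] (by simp)
  tauto

/-- Taking logarithms in the counting bound gives `X.card - c₀ ≤ Q + X.card / 4`, where Q is the
sample size. -/
theorem card_le_of_shatters_traces [DecidableEq (List A)] (hL : IsDeterministicPac R L)
    (hmL : HasSampleSize R L mL) (hs : 1 ≤ s) (hn : 24 ≤ n) (hδ : 0 < fracVal δ)
    {c₀ : ℝ} (hc₀ : 0 ≤ c₀) (hδ₁ : (2 : ℝ) ^ (-c₀) ≤ 1 - fracVal δ) {X : Finset (List A)}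
    (hX : (R.traces n s).Shatters X) :
    (X.card : ℝ) ≤ 4 / 3 * (mL n s (1 / (2 * n)) (fracVal δ) + c₀) := by
  have hn1 : 1 ≤ n := by omega
  obtain ⟨S, hS, hXS⟩ := hX.exists_superset
  obtain ⟨hS1, r, hr, -⟩ := RepSystem.mem_traces.1 hS
  have hQ := sampleSize_nonneg hmL hs hn1 hδ r hr
  rcases X.eq_empty_or_nonempty with rfl | hne
  · simp only [Finset.card_empty, Nat.cast_zero]; positivity
  have hlen : ∀ x ∈ X, x.length ≤ n := fun x hx => hS1 x (hXS hx)
  have key := two_pow_card_le_of_shattered hL hmL hs hn1 hδ hne hlen fun T hT => by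
    obtain ⟨u, hu, rfl⟩ := hX hT
    obtain ⟨-, r, hr, hr'⟩ := RepSystem.mem_traces.1 hu
    exact ⟨r, hr, fun x hx => by rw [hr' x (hlen x hx)]; simp [hx]⟩
  set Q := mL n s (1 / (2 * n)) (fracVal δ)
  have h : (2 : ℝ) ^ (-c₀ + X.card) ≤ 2 ^ (Q + X.card / 4) := by
    rw [Real.rpow_add (by norm_num), Real.rpow_add (by norm_num), Real.rpow_natCast]
    calc (2 : ℝ) ^ (-c₀) * 2 ^ X.card ≤ (1 - fracVal δ) * 2 ^ X.card := by gcongr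
      _ ≤ _ := key
      _ ≤ 2 ^ Q * 2 ^ ((X.card : ℝ) / 4) := by
        gcongr
        · rw [← Real.rpow_natCast]
          exact Real.rpow_le_rpow_of_exponent_le (by norm_num) (Nat.floor_le hQ)
        · exact card_filter_powerset_le X hn
  rw [Real.rpow_le_rpow_left_iff (by norm_num)] at h
  linarith

/-- A pac-learnable system has so few behaviours that they can be numbered by
`2 n m(n, s, 1/(2n), δ) ℓ + O(1)` bits. -/
theorem exists_clog_card_traces_le (hL : IsDeterministicPac R L) (hmL : HasSampleSize R L mL)
    {γ₀ : ℝ} (hγ₀ : γ₀ < 1) : ∃ C : ℕ, ∀ s n : ℕ, 1 ≤ s → 1 ≤ n → ∀ γ : ℕ × ℕ, 0 < fracVal γ →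
      fracVal γ ≤ γ₀ → (∃ r : R.reps, (r : List G).length ≤ s) →
      (Nat.clog 2 (R.traces n s).card : ℝ) ≤
        2 * mL n s (1 / (2 * n)) (fracVal γ) * n * bitsPerSymbol A + C := by
  classical
  -- The bits lost to the failure probability, uniformly for `γ ≤ γ₀`.
  let c₀ : ℝ := max 0 (-Real.logb 2 (1 - γ₀))
  have hc₀ : 0 ≤ c₀ := le_max_left _ _
  have hγ₁ : 0 < 1 - γ₀ := by linarith
  have hc₁ : (2 : ℝ) ^ (-c₀) ≤ 1 - γ₀ := by
    have : -c₀ ≤ Real.logb 2 (1 - γ₀) := by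
      have := le_max_right 0 (-Real.logb 2 (1 - γ₀))
      linarith
    exact (Real.le_logb_iff_rpow_le (by norm_num) hγ₁).1 this
  -- Beyond `n₀` the error sets are small enough to count (24), and `Q ≥ n (1 - γ₀) ≥ 8 * c₀` holds
  -- once there are more than two traces.
  let n₀ : ℕ := max 24 ⌈8 * c₀ / (1 - γ₀)⌉₊
  refine ⟨2 * max 2 (Nat.card A) ^ n₀ + 1, ?_⟩
  rintro s n hs hn γ hγ hγ' ⟨r, hr⟩
  have hQ := sampleSize_nonneg hmL hs hn hγ r hr
  set Q := mL n s (1 / (2 * n)) (fracVal γ) with hQdef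
  have hℓ : 1 ≤ bitsPerSymbol A := one_le_bitsPerSymbol
  have hbase : 0 ≤ 2 * Q * n * bitsPerSymbol A := by positivity
  have small : ∀ k : ℕ, (R.traces n s).card ≤ 2 ^ k → k ≤ 2 * max 2 (Nat.card A) ^ n₀ + 1 →
      (Nat.clog 2 (R.traces n s).card : ℝ) ≤ 2 * Q * n * bitsPerSymbol A +
        (2 * max 2 (Nat.card A) ^ n₀ + 1 : ℕ) := by
    intro k h1 h2
    have h3 : Nat.clog 2 (R.traces n s).card ≤ 2 * max 2 (Nat.card A) ^ n₀ + 1 :=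
      ((Nat.clog_le_iff_le_pow one_lt_two).2 h1).trans h2
    have h4 : (Nat.clog 2 (R.traces n s).card : ℝ) ≤
      (2 * max 2 (Nat.card A) ^ n₀ + 1 : ℕ) := by exact_mod_cast h3
    linarith
  rcases le_or_gt (R.traces n s).card 2 with h2 | h2
  · exact small 1 (by simpa using h2) (by omega)
  rcases le_or_gt n n₀ with hnn | hnn
  · exact small _ (card_traces_le_two_pow R n s) ((length_wordsUpTo_le_of_le hnn).trans (by omega))
  have hn24 : 24 ≤ n := (le_max_left _ _).trans hnn.le
  have hδ₁ : 1 - γ₀ ≤ 1 - fracVal γ := by linarith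
  have hQn := mul_le_sampleSize_of_two_lt_card_traces hL hmL hs hn hγ h2
  have hQc : 8 * c₀ ≤ Q := by
    have h3 : 8 * c₀ / (1 - γ₀) ≤ n := (Nat.le_ceil _).trans
      (by exact_mod_cast (le_max_right 24 _).trans hnn.le)
    rw [div_le_iff₀ hγ₁] at h3
    refine h3.trans (le_trans ?_ hQn)
    gcongr
  have hd : ∀ X : Finset (List A), (R.traces n s).Shatters X → X.card ≤ ⌊4 / 3 * (Q + c₀)⌋₊ :=
    fun X hX => Nat.le_floor
      (card_le_of_shatters_traces hL hmL hs hn24 hγ hc₀ (hc₁.trans hδ₁) hX)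
  have hcard := card_traces_le_two_rpow n s hd
  -- Here `c₀ ≤ Q / 8`, and 4/3 · 9/8 = 3/2. The remaining factor 4/3 up to the target 2 absorbs the
  -- 1 in `n * bitsPerSymbol A + 1`.
  have hd' : ((⌊4 / 3 * (Q + c₀)⌋₊ : ℕ) : ℝ) ≤ 3 / 2 * Q :=
    (Nat.floor_le (by positivity)).trans (by linarith)
  have hnℓ : 24 ≤ n * bitsPerSymbol A := by
    have : (24 : ℝ) ≤ n := by exact_mod_cast hn24
    nlinarith
  have hlog : Real.logb 2 (R.traces n s).card ≤ 2 * Q * n * bitsPerSymbol A := by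
    rw [Real.logb_le_iff_le_rpow (by norm_num) (by positivity)]
    refine hcard.trans (Real.rpow_le_rpow_of_exponent_le (by norm_num) ?_)
    calc _ ≤ 3 / 2 * Q * (n * bitsPerSymbol A + 1) := by gcongr
      _ ≤ 3 / 2 * Q * (4 / 3 * (n * bitsPerSymbol A)) := by gcongr; linarith
      _ = _ := by ring
  have hclog : (Nat.clog 2 (R.traces n s).card : ℝ) < Real.logb 2 (R.traces n s).card + 1 := by
    rw [← Real.natCeil_logb_natCast]
    exact Nat.ceil_lt_add_one (Real.logb_nonneg (by norm_num) (by exact_mod_cast (by omega)))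
  have hC : (1 : ℝ) ≤ (2 * max 2 (Nat.card A) ^ n₀ + 1 : ℕ) := by exact_mod_cast (by omega)
  linarith

end TraceBounds

/-! ### The accuracy parameter -/

/-- The difference `φ x - x * m` is strictly decreasing for positive `x`, which gives uniqueness;
existence is the intermediate value theorem. -/
theorem existsUnique_accuracy {φ : ℝ → ℝ} {m a : ℝ} (hm : 0 < m) (ha : 0 < a)
    (hφ : ∀ x y, 0 < x → x ≤ y → φ y ≤ φ x) (ham : φ a ≤ a * m) (hcont : ContinuousOn φ (Ioi 0))
    (hpos : ∃ x, 0 < x ∧ 0 < φ x) : ∃! x, 0 < x ∧ φ x = x * m := by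
  have huniq : ∀ x y, 0 < x → φ x = x * m → φ y = y * m → ¬x < y := by
    intro x y hx h1 h2 hlt
    have h3 := hφ x y hx hlt.le
    rw [h1, h2] at h3
    nlinarith
  obtain ⟨x₀, hx₀, hφ₀⟩ := hpos
  -- A left endpoint where the difference is nonnegative: `b * m ≤ φ x₀ ≤ φ b`.
  set b := min a (min x₀ (φ x₀ / m)) with hb
  have hb0 : 0 < b := lt_min ha (lt_min hx₀ (by positivity))
  have hba : b ≤ a := min_le_left _ _
  have hbm : b * m ≤ φ b := by
    have h1 : b ≤ φ x₀ / m := (min_le_right _ _).trans (min_le_right _ _)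
    rw [le_div_iff₀ hm] at h1
    exact h1.trans (hφ b x₀ hb0 ((min_le_right _ _).trans (min_le_left _ _)))
  have hg : ContinuousOn (fun x => φ x - x * m) (Icc b a) :=
    (hcont.mono fun x hx => hb0.trans_le hx.1).sub (continuous_mul_const m).continuousOn
  obtain ⟨x, hx, hx0⟩ := intermediate_value_Icc' hba hg
    (show (0 : ℝ) ∈ Icc (φ a - a * m) (φ b - b * m) from ⟨by linarith, by linarith⟩)
  have hx1 : 0 < x := hb0.trans_le hx.1
  have hx2 : φ x = x * m := by simp only at hx0; linarith
  refine ⟨x, ⟨hx1, hx2⟩, fun y hy => ?_⟩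
  exact le_antisymm (not_lt.1 (huniq x y hx1 hx2 hy.2)) (not_lt.1 (huniq y x hy.1 hy.2 hx2))

theorem OccamDomain.eps_le {mL : ℕ → ℕ → ℝ → ℝ → ℝ} (hdec : IsDecreasingSampleSize mL)
    {eps : ℕ → ℕ → ℕ → ℝ → ℝ} {m n s : ℕ} (hn : 1 ≤ n) (hs : 1 ≤ s) {γ : ℝ} (hγ : 0 < γ)
    (h : OccamDomain mL eps m n s γ) : eps m n s γ ≤ 1 / (2 * (n : ℝ)) := by
  obtain ⟨hm, h1, h2, h3⟩ := h
  have hn0 : (0 : ℝ) < n := by exact_mod_cast hn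
  have hm0 : (0 : ℝ) < m := by exact_mod_cast hm
  by_contra! hlt
  have h4 := hdec n s hn hs _ _ γ γ (by positivity) hlt.le hγ le_rfl
  rw [h3] at h4
  rw [div_lt_iff₀ (by positivity)] at hlt
  have h5 : 2 * (n : ℝ) * (eps m n s γ * m) ≤ m := (mul_le_mul_of_nonneg_left h4
    (by positivity)).trans h1
  nlinarith

/-- If the accuracy did not drop, the sample size could not rise, yet its value `eps * m` would have
grown with `m`. -/
theorem OccamDomain.eps_lt_eps {mL : ℕ → ℕ → ℝ → ℝ → ℝ} (hdec : IsDecreasingSampleSize mL)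
    {eps : ℕ → ℕ → ℕ → ℝ → ℝ} {m m' n s : ℕ} (hn : 1 ≤ n) (hs : 1 ≤ s) {γ : ℝ} (hγ : 0 < γ)
    (hmm : m < m') (h : OccamDomain mL eps m n s γ) (h' : OccamDomain mL eps m' n s γ) :
    eps m' n s γ < eps m n s γ := by
  by_contra! hle
  have h1 := hdec n s hn hs _ _ γ γ h.2.2.1 hle hγ le_rfl
  rw [h.2.2.2, h'.2.2.2] at h1
  have h2 : (m : ℝ) < m' := by exact_mod_cast hmm
  have h3 := h'.2.2.1
  have h4 : (0 : ℝ) ≤ m := Nat.cast_nonneg m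
  nlinarith

instance : IsProbabilityMeasure coinMeasure := by
  unfold coinMeasure; infer_instance

/-! ### The Occam-algorithm -/

/-- The Occam-algorithm that outputs the first representation consistent with the sample; it makes
no use of its coin flips. -/
noncomputable def RepSystem.occam {G A : Type*} [Finite G] (R : RepSystem G A) :
    TokenAlgorithm (ℕ × ℕ × (ℕ × ℕ) × List (List A × Bool)) Bool (List G) :=
  fun q => ((R.firstConsistent q.1.2.1 q.1.2.2.2).map some : Option (Option (List G)))

theorem RepSystem.partrec_occam {G A : Type*} [Finite G] [Primcodable G] [Primcodable A]
    {R : RepSystem G A} (hR : R.IsDecidable) : Partrec R.occam := by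
  have h1 : Computable fun q : (ℕ × ℕ × (ℕ × ℕ) × List (List A × Bool)) × List Bool => q.1.2.1 :=
    Computable.fst.comp (Computable.snd.comp .fst)
  have h2 : Computable fun q : (ℕ × ℕ × (ℕ × ℕ) × List (List A × Bool)) × List Bool =>
      q.1.2.2.2 :=
    Computable.snd.comp (Computable.snd.comp (Computable.snd.comp .fst))
  exact (Computable.option_map (hR.computable_firstConsistent.comp h1 h2)
    (Computable.option_some.comp .snd).to₂).ofOption

theorem RepSystem.exists_condK_firstConsistent_le {G A : Type*} [Finite G] [Finite A]
    [Primcodable G] [Primcodable A] {R : RepSystem G A} (hR : R.IsDecidable)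
    {U : List Bool × ℕ →. ℕ} (hU : IsOptimalPrefixMachine U) :
    ∃ C : ℕ, ∀ (n s : ℕ) (r r' : R.reps) (sample : List (List A × Bool)),
      (∀ p ∈ sample, p.1.length ≤ n) → R.firstConsistent s sample = some (r' : List G) →
      condK U (r' : List G) ((r : List G), n, s) ≤
        ((Nat.clog 2 (R.traces n s).card + C : ℕ) : ℕ∞) := by
  -- The default `[]` is never used: each behaviour comes from a representation of length at most
  -- `s`, so the search on it succeeds.
  let F : List G × ℕ × ℕ → List (List G) := fun y =>
    (R.behaviours y.2.1 y.2.2).map fun t => (R.firstConsistent y.2.2 t).getD []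
  have hF : Computable F := by
    have h1 : Computable fun q : (List G × ℕ × ℕ) × List (List A × Bool) =>
        R.firstConsistent q.1.2.2 q.2 :=
      hR.computable_firstConsistent.comp (Computable.snd.comp (Computable.snd.comp .fst)) .snd
    exact Computable.list_map (hR.computable_behaviours.comp (Computable.fst.comp .snd)
      (Computable.snd.comp .snd)) (Computable.option_getD h1 (Computable.const [])).to₂
  obtain ⟨C, hC⟩ := exists_condK_le_of_mem_list hU hF
  refine ⟨C, fun n s r r' sample hlen h => (hC ((r : List G), n, s) r' ?_).trans ?_⟩
  · have hr' : (r' : List G).length ≤ s := mem_wordsUpTo.1 (List.mem_of_find?_eq_some h)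
    refine List.mem_map.2 ⟨R.fullSample n r', mem_behaviours.2 ⟨r', hr', rfl⟩, ?_⟩
    rw [firstConsistent_fullSample hlen h]
    rfl
  · have : (F ((r : List G), n, s)).length ≤ (R.traces n s).card := by
      simpa [F] using R.length_behaviours_le n s
    exact_mod_cast Nat.add_le_add_right (Nat.clog_mono_right 2 this) C

theorem RepSystem.isOccamAlgorithm_occam {G A : Type*} [Finite G] [Finite A] [Primcodable G]
    [Primcodable A] {R : RepSystem G A} (hR : R.IsDecidable)
    {L : TokenAlgorithm (ℕ × ℕ × (ℕ × ℕ) × (ℕ × ℕ)) (List A × Bool) (List G)}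
    (hL : IsDeterministicPac R L) {mL : ℕ → ℕ → ℝ → ℝ → ℝ} (hmL : HasSampleSize R L mL)
    (hdec : IsDecreasingSampleSize mL) {U : List Bool × ℕ →. ℕ} (hU : IsOptimalPrefixMachine U)
    (eps : ℕ → ℕ → ℕ → ℝ → ℝ) :
    IsOccamAlgorithm R U R.occam (OccamDomain mL eps)
      (fun m n s γ => 1 / (2 * eps m n s γ * (n : ℝ) * bitsPerSymbol A)) := by
  have hℓ : 0 < bitsPerSymbol A := zero_lt_one.trans_le one_le_bitsPerSymbol
  refine ⟨R.partrec_occam hR, ?_, ?_⟩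
  · intro n s hn hs γ hγ m m' hmm h h'
    have h1 := OccamDomain.eps_lt_eps hdec hn hs hγ hmm h h'
    have h2 := h'.2.2.1
    have hn0 : (0 : ℝ) < n := by exact_mod_cast hn
    exact one_div_lt_one_div_of_lt (by positivity) (by gcongr)
  · intro γ₀ hγ₀
    obtain ⟨C₁, hC₁⟩ := exists_clog_card_traces_le hL hmL hγ₀
    obtain ⟨C₂, hC₂⟩ := R.exists_condK_firstConsistent_le hR hU
    -- The 1 makes the inequality strict.
    refine ⟨C₁ + C₂ + 1, ?_⟩
    intro s n hs hn γ hγ hγ' r hr xs hxs hdom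
    obtain ⟨r', hr', hlen', hcons⟩ := R.exists_firstConsistent r hr xs
    have hK := hC₂ n s r r' (xs.map (R.label r)) (by simpa [label] using hxs) hr'
    have hclog := hC₁ s n hs hn γ hγ hγ' ⟨r, hr⟩
    have hn0 : (0 : ℝ) < n := by exact_mod_cast hn
    have hε := hdom.2.2.1
    have hQ : mL n s (1 / (2 * n)) (fracVal γ) ≤
        eps xs.length n s (fracVal γ) * xs.length := by
      rw [← hdom.2.2.2]
      exact hdec n s hn hs _ _ _ _ hε (hdom.eps_le hdec hn hs hγ) hγ le_rfl
    have hbound : (Nat.clog 2 (R.traces n s).card : ℝ) ≤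
        (xs.length : ℝ) / (1 / (2 * eps xs.length n s (fracVal γ) * n * bitsPerSymbol A)) + C₁ := by
      rw [div_div_eq_mul_div, div_one]
      calc _ ≤ 2 * mL n s (1 / (2 * n)) (fracVal γ) * n * bitsPerSymbol A + C₁ := hclog
        _ ≤ 2 * (eps xs.length n s (fracVal γ) * xs.length) * n * bitsPerSymbol A + C₁ := by gcongr
        _ = _ := by ring
    set B := (xs.length : ℝ) / (1 / (2 * eps xs.length n s (fracVal γ) * n * bitsPerSymbol A))
      with hB
    have hB0 : 0 ≤ B := by positivity
    have hfinal : ((condK U (r' : List G) ((r : List G), n, s) : ℕ∞) : ℝ≥0∞) <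
        ENNReal.ofReal B + ((C₁ + C₂ + 1 : ℕ) : ℝ≥0∞) := by
      calc ((condK U (r' : List G) ((r : List G), n, s) : ℕ∞) : ℝ≥0∞)
          ≤ ((Nat.clog 2 (R.traces n s).card + C₂ : ℕ) : ℝ≥0∞) := by
            exact_mod_cast ENat.toENNReal_le.2 hK
        _ = ENNReal.ofReal (Nat.clog 2 (R.traces n s).card + C₂ : ℕ) :=
            (ENNReal.ofReal_natCast _).symm
        _ < ENNReal.ofReal (B + (C₁ + C₂ + 1 : ℕ)) := by
            rw [ENNReal.ofReal_lt_ofReal_iff (by positivity)]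
            push_cast
            linarith
        _ = ENNReal.ofReal B + ((C₁ + C₂ + 1 : ℕ) : ℝ≥0∞) := by
            rw [ENNReal.ofReal_add hB0 (by positivity), ENNReal.ofReal_natCast]
    -- The search stops before any coin is flipped, so success is certain.
    have huniv : {w : ℕ → Bool | ∃ (t : ℕ) (r' : R.reps),
          R.occam.Outputs (n, s, γ, xs.map (R.label r)) w t (r' : List G) ∧
          (∀ x ∈ xs, x ∈ R.concept r' ↔ x ∈ R.concept r) ∧
          ((condK U (r' : List G) ((r : List G), n, s) : ℕ∞) : ℝ≥0∞) <
            ENNReal.ofReal B + ((C₁ + C₂ + 1 : ℕ) : ℝ≥0∞)} = Set.univ := by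
      refine Set.eq_univ_of_forall fun w => ⟨0, r', ⟨by simp, ?_⟩, hcons, hfinal⟩
      simp [occam, hr']
    rw [huniv, measure_univ, ENNReal.ofReal_le_one]
    linarith

theorem theorem2 {G A : Type*} [Finite G] [Finite A] [Primcodable G] [Primcodable A]
    (R : RepSystem G A) (hR : R.IsDecidable)
    (L : TokenAlgorithm (ℕ × ℕ × (ℕ × ℕ) × (ℕ × ℕ)) (List A × Bool) (List G))
    (hL : IsDeterministicPac R L)
    (mL : ℕ → ℕ → ℝ → ℝ → ℝ) (hmL : HasSampleSize R L mL) (hdec : IsDecreasingSampleSize mL)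
    (E : List G × List A →. List G) (e : ℕ → ℕ → ℕ) (hE : IsExceptionHandler R E e)
    (U : List Bool × ℕ →. ℕ) (hU : IsOptimalPrefixMachine U) :
    (∀ n s m : ℕ, 1 ≤ n → 1 ≤ s → 1 ≤ m → ∀ γ : ℝ, 0 < γ →
      2 * (n : ℝ) * mL n s (1 / (2 * (n : ℝ))) γ ≤ (m : ℝ) →
      ContinuousOn (fun ε => mL n s ε γ) (Ioi 0) → (∃ ε, 0 < ε ∧ 0 < mL n s ε γ) →
      ∃! ε : ℝ, 0 < ε ∧ mL n s ε γ = ε * (m : ℝ)) ∧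
    ∀ eps : ℕ → ℕ → ℕ → ℝ → ℝ,
      (∀ m n s : ℕ, 1 ≤ n → 1 ≤ s → ∀ γ : ℝ, 0 < γ → OccamDomain mL eps m n s γ →
        eps m n s γ ≤ 1 / (2 * (n : ℝ))) ∧
      ∃ O : TokenAlgorithm (ℕ × ℕ × (ℕ × ℕ) × List (List A × Bool)) Bool (List G),
        IsOccamAlgorithm R U O (OccamDomain mL eps)
          (fun m n s γ => 1 / (2 * eps m n s γ * (n : ℝ) * bitsPerSymbol A)) := by
  refine ⟨fun n s m hn hs hm γ hγ h hcont hpos => ?_, fun eps => ⟨?_, R.occam, ?_⟩⟩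
  · have hn0 : (0 : ℝ) < n := by exact_mod_cast hn
    refine existsUnique_accuracy (a := 1 / (2 * n)) (by exact_mod_cast hm) (by positivity)
      (fun x y hx hxy => hdec n s hn hs x y γ γ hx hxy hγ le_rfl) ?_ hcont hpos
    rw [div_mul_eq_mul_div, one_mul, le_div_iff₀ (by positivity), mul_comm]
    exact h
  · exact fun m n s hn hs γ hγ h => h.eps_le hdec hn hs hγ
  · exact RepSystem.isOccamAlgorithm_occam hR hL hmL hdec hU eps
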